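/- Let $d\ge 1$ be an integer, let $p\in\bigl(2-\tfrac{2}{3d+2},\,2+\tfrac2d\bigr)$ and $\Lambda\in(0,\infty)$, and set $$q = p\,\frac{4d+2}{d(p+2)}.$$ Then there is a constant $C=C(p,d,\Lambda)>0$ with the following property. Let $A:\mathbb R^{1+2d}\times\mathbb R\times\mathbb R^d\to\mathbb R^d$ be any Carathéodory vector field, that is, $A(\cdot,\cdot,\cdot,\eta,\xi)$ is measurable for every $(\eta,\xi)\in\mathbb R\times\mathbb R^d$ and $A(t,x,v,\cdot,\cdot)$ is continuous for a.e. $(t,x,v)\in\mathbb R^{1+2d}$, with $$|A(t,x,v,\eta,\xi)|\le\Lambda|\xi|^{p-1}\qquad\text{for a.e. }(t,x,v)\in\mathbb R^{1+2d}\text{ and all }\eta\in\mathbb R,\ \xi\in\mathbb R^d$$ (no lower bound $A(t,x,v,\eta,\xi)\cdot\xi\ge\lambda|\xi|^p$ is required). Let $f\in L^2(\mathbb R^{1+2d})$ be real-valued, with weak velocity gradient $\nabla_v f\in L^p(\mathbb R^{1+2d};\mathbb R^d)$, and let $f$ be a weak solution on $\mathbb R^{1+2d}$ of $$(\partial_t+v\cdot\nabla_x)f-\nabla_v\cdot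 A(t,x,v,f,\nabla_v f)=0,$$ that is, for every $\varphi\in C_c^\infty(\mathbb R^{1+2d})$, $$\int_{\mathbb R^{1+2d}}\Bigl(-f\,(\partial_t+v\cdot\nabla_x)\varphi+A(t,x,v,f,\nabla_v f)\cdot\nabla_v\varphi\Bigr)\,d(t,x,v)=0.$$ Then $f\in L^q(\mathbb R^{1+2d})$ and $$\|f\|_{L^q(\mathbb R^{1+2d})}\le C\,\|\nabla_v f\|_{L^p(\mathbb R^{1+2d})}^{\frac{(p+2)d+p}{4d+2}}.$$ -/

import Mathlib

open MeasureTheory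
open scoped ENNReal NNReal ContDiff

noncomputable section

namespace KineticPGrowth

/-- Euclidean space `ℝ^d`. -/
abbrev Vec (d : ℕ) : Type := EuclideanSpace ℝ (Fin d)

/-- The space `ℝ^{1+2d}` of points `z = (t, x, v)`, with Lebesgue measure as `volume`. -/
abbrev Phase (d : ℕ) : Type := ℝ × Vec d × Vec d

/-- Test functions `φ ∈ C_c^∞(ℝ^{1+2d})`. -/
def IsTest {d : ℕ} (φ : Phase d → ℝ) : Prop :=
  ContDiff ℝ ∞ φ ∧ HasCompactSupport φ

/-- The classical velocity gradient `∇_v φ`. -/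
def velGrad {d : ℕ} (φ : Phase d → ℝ) (z : Phase d) : Vec d :=
  gradient (fun w : Vec d => φ (z.1, z.2.1, w)) z.2.2

/-- The classical transport derivative `(∂_t + v · ∇_x) φ`. -/
def transport {d : ℕ} (φ : Phase d → ℝ) (z : Phase d) : ℝ :=
  deriv (fun s : ℝ => φ (s, z.2.1, z.2.2)) z.1
    + inner ℝ z.2.2 (gradient (fun y : Vec d => φ (z.1, y, z.2.2)) z.2.1)

/-- `g` is the weak (distributional) velocity gradient `∇_v f` of `f` on `ℝ^{1+2d}`. -/
structure IsWeakVelGrad {d : ℕ} (f : Phase d → ℝ) (g : Phase d → Vec d) : Prop where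
  locallyIntegrable : LocallyIntegrable f
  locallyIntegrable_grad : LocallyIntegrable g
  integral_eq : ∀ φ : Phase d → ℝ, IsTest φ → ∀ i : Fin d,
    ∫ z, f z * velGrad φ z i = - ∫ z, g z i * φ z

/-- Carathéodory vector fields `A(t, x, v, η, ξ)`. Measurability is meant in the sense of Lebesgue. -/
structure IsCaratheodory {d : ℕ} (A : Phase d → ℝ → Vec d → Vec d) : Prop where
  measurable : ∀ (η : ℝ) (ξ : Vec d), AEStronglyMeasurable (fun z => A z η ξ)
  continuous : ∀ᵐ z : Phase d, Continuous (fun y : ℝ × Vec d => A z y.1 y.2)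

/-- The growth bound `|A(t, x, v, η, ξ)| ≤ Λ |ξ|^{p-1}`. -/
def HasGrowth {d : ℕ} (p Λ : ℝ) (A : Phase d → ℝ → Vec d → Vec d) : Prop :=
  ∀ᵐ z : Phase d, ∀ (η : ℝ) (ξ : Vec d), ‖A z η ξ‖ ≤ Λ * ‖ξ‖ ^ (p - 1)

/-- `f`, with weak velocity gradient `g = ∇_v f`, is a weak solution on `ℝ^{1+2d}` of
`(∂_t + v · ∇_x) f - ∇_v · A(t, x, v, f, ∇_v f) = 0`. -/
structure IsWeakSolution {d : ℕ} (A : Phase d → ℝ → Vec d → Vec d)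
    (f : Phase d → ℝ) (g : Phase d → Vec d) : Prop where
  isWeakVelGrad : IsWeakVelGrad f g
  integral_eq : ∀ φ : Phase d → ℝ, IsTest φ →
    ∫ z, (-(f z * transport φ z) + inner ℝ (A z (f z) (g z)) (velGrad φ z)) = 0

end KineticPGrowth

end

namespace KineticPGrowth

/-! Write T = ∂_t + v·∇_x, g = ∇_v f and F = A(·, f, g), so that T f = ∇_v · F. Consider the
dilations δ_u(t, x, v) = (a₀e^{αu} t, a₀b₀e^{(α+β)u} x, b₀e^{βu} v), normalised to have Jacobian
e^u, and the averages f_u(z) = ∫ f(z ∘ δ_u w) ρ(w) dw, where ∘ is the Galilean group law. Since f ∈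
L², f_u tends to f in L² as u → -∞ and to 0 pointwise as u → +∞, so f is recovered by integrating
-∂_u f_u over all scales.

The derivative -∂_u f_u pairs the rescaled f with the dilation generator applied to ρ. This
generator contains x-derivatives, about which the equation says nothing directly, but ∂_{x_i} =
[∂_{v_i}, T] rewrites it with outer derivatives T and ∂_{v_i} only (`dilGen_eq`). Moving these onto
f leaves local averages of |F| with weight e^{(α-β)u} and of |g| with weight e^{βu}. Hence |f| is
bounded almost everywhere by two potentials (`enorm_mollify_le`, `ae_enorm_le_of_mollify_le`).

A potential of order σ maps L^r to L^q when 1/q = 1/r - σ (`potential_norm_le`). Sending g ∈ L^p by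
order s = β and F ∈ L^{p'} by order s' = α - β to the same L^q, under the Jacobian normalisation,
determines s, s' and q; the two endpoints of the range of p are exactly s' > 0 and s > 0.

One free scaling μ = b₀ remains after normalisation (`exists_norm_le_of_isWeakTriple`). The growth
bound gives ‖F‖_{p'} ≤ Λ ‖g‖_p^{p-1}, and choosing μ as a power of ‖g‖_p balances the two terms and
produces the stated exponent. -/

theorem lintegral_comp_const_add_smul {E : Type*} [NormedAddCommGroup E] [NormedSpace ℝ E]
    [MeasurableSpace E] [BorelSpace E] [FiniteDimensional ℝ E] (μ : Measure E)
    [μ.IsAddHaarMeasure] (a : E) {c : ℝ} (hc : 0 < c) {G : E → ℝ≥0∞} (hG : Measurable G) :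
    ∫⁻ x, G (a + c • x) ∂μ = ENNReal.ofReal ((c ^ Module.finrank ℝ E)⁻¹) * ∫⁻ x, G x ∂μ := by
  have h1 : ∫⁻ x, G (a + c • x) ∂μ = ∫⁻ x, G (a + x) ∂(Measure.map (c • ·) μ) := by
    rw [lintegral_map (by fun_prop) (by fun_prop)]
  rw [h1, Measure.map_addHaar_smul μ hc.ne', lintegral_smul_measure, lintegral_add_left_eq_self,
    abs_of_pos (by positivity), smul_eq_mul]

/-! ### Galilean translations, anisotropic dilations and their Jacobians. -/

variable {d : ℕ}

/-- The point `z ∘ δ w` obtained by following the Galilean group law after the anisotropic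
dilation `δ (t, x, v) = (a t, a b x, b v)`. -/
noncomputable def kmap (a b : ℝ) (z w : Phase d) : Phase d :=
  (z.1 + a * w.1, z.2.1 + ((a * b) • w.2.1 + (a * w.1) • z.2.2), z.2.2 + b • w.2.2)

/-- The inverse of `kmap a b z`. -/
noncomputable def kinv (a b : ℝ) (z y : Phase d) : Phase d :=
  (a⁻¹ * (y.1 - z.1), (a * b)⁻¹ • (y.2.1 - z.2.1 - (y.1 - z.1) • z.2.2), b⁻¹ • (y.2.2 - z.2.2))

theorem kinv_kmap {a b : ℝ} (ha : 0 < a) (hb : 0 < b) (z w : Phase d) :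
    kinv a b z (kmap a b z w) = w := by
  have hab : a * b ≠ 0 := by positivity
  refine Prod.ext ?_ (Prod.ext ?_ ?_)
  · simp [kinv, kmap, ha.ne']
  · have : z.2.1 + ((a * b) • w.2.1 + (a * w.1) • z.2.2) - z.2.1 - (z.1 + a * w.1 - z.1) • z.2.2
        = (a * b) • w.2.1 := by module
    simp only [kinv, kmap, this, smul_smul, inv_mul_cancel₀ hab, one_smul]
  · simp [kinv, kmap, smul_smul, hb.ne']

theorem kmap_kinv {a b : ℝ} (ha : 0 < a) (hb : 0 < b) (z y : Phase d) :
    kmap a b z (kinv a b z y) = y := by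
  have hab : a * b ≠ 0 := by positivity
  refine Prod.ext ?_ (Prod.ext ?_ ?_)
  · simp [kinv, kmap, ha.ne']
  · simp only [kinv, kmap, smul_smul, mul_inv_cancel₀ hab, one_smul, mul_inv_cancel_left₀ ha.ne']
    module
  · simp [kinv, kmap, smul_smul, hb.ne']

theorem continuous_kmap {T : Type*} [TopologicalSpace T] {a b : T → ℝ} {z w : T → Phase d}
    (ha : Continuous a) (hb : Continuous b) (hz : Continuous z) (hw : Continuous w) :
    Continuous fun t => kmap (a t) (b t) (z t) (w t) := by
  unfold kmap; fun_prop

theorem continuous_kinv (a b : ℝ) (z : Phase d) : Continuous (kinv a b z) := by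
  unfold kinv; fun_prop

theorem contDiff_kinv (a b : ℝ) (z : Phase d) : ContDiff ℝ ∞ (kinv a b z) := by
  unfold kinv; fun_prop

/-- `kmap a b z` as a homeomorphism. -/
noncomputable def kmapHomeo {a b : ℝ} (ha : 0 < a) (hb : 0 < b) (z : Phase d) : Phase d ≃ₜ Phase d where
  toFun := kmap a b z
  invFun := kinv a b z
  left_inv := kinv_kmap ha hb z
  right_inv := kmap_kinv ha hb z
  continuous_toFun := continuous_kmap continuous_const continuous_const continuous_const
    continuous_id
  continuous_invFun := continuous_kinv a b z

theorem measurable_kmap (a b : ℝ) (z : Phase d) : Measurable (kmap a b z) :=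
  (continuous_kmap continuous_const continuous_const continuous_const continuous_id).measurable

/-- The Jacobian of `kmap a b z`. -/
theorem lintegral_kmap {a b : ℝ} (ha : 0 < a) (hb : 0 < b) (z : Phase d) {G : Phase d → ℝ≥0∞}
    (hG : Measurable G) :
    ∫⁻ w, G (kmap a b z w) = ENNReal.ofReal ((a ^ (1 + d) * b ^ (2 * d))⁻¹) * ∫⁻ y, G y := by
  have hm : Measurable fun w => G (kmap a b z w) := hG.comp (measurable_kmap a b z)
  have hab : 0 < a * b := mul_pos ha hb
  have hv : ∀ t x, ∫⁻ v : Vec d, G (kmap a b z (t, x, v)) = ENNReal.ofReal ((b ^ d)⁻¹) *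
      ∫⁻ v, G (z.1 + a * t, z.2.1 + ((a * b) • x + (a * t) • z.2.2), v) := by
    intro t x
    have := lintegral_comp_const_add_smul (volume : Measure (Vec d)) z.2.2 hb
      (G := fun v => G (z.1 + a * t, z.2.1 + ((a * b) • x + (a * t) • z.2.2), v)) (by fun_prop)
    simpa [kmap] using this
  have hx : ∀ t, ∫⁻ x : Vec d, ∫⁻ v : Vec d,
      G (z.1 + a * t, z.2.1 + ((a * b) • x + (a * t) • z.2.2), v)
      = ENNReal.ofReal (((a * b) ^ d)⁻¹) * ∫⁻ x : Vec d, ∫⁻ v : Vec d, G (z.1 + a * t, x, v) := by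
    intro t
    have := lintegral_comp_const_add_smul (volume : Measure (Vec d)) (z.2.1 + (a * t) • z.2.2) hab
      (G := fun x => ∫⁻ v : Vec d, G (z.1 + a * t, x, v))
      (Measurable.lintegral_prod_right' (f := fun q : Vec d × Vec d => G (z.1 + a * t, q))
        (by fun_prop))
    rw [finrank_euclideanSpace_fin] at this
    rw [← this]
    refine lintegral_congr fun x => lintegral_congr fun v => ?_
    congr 3
    abel
  have ht : ∫⁻ t : ℝ, ∫⁻ x : Vec d, ∫⁻ v : Vec d, G (z.1 + a * t, x, v)
      = ENNReal.ofReal (a⁻¹) * ∫⁻ t : ℝ, ∫⁻ x : Vec d, ∫⁻ v : Vec d, G (t, x, v) := by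
    have := lintegral_comp_const_add_smul (volume : Measure ℝ) z.1 ha
      (G := fun t => ∫⁻ q : Vec d × Vec d, G (t, q))
      (Measurable.lintegral_prod_right' (f := G) hG)
    simp only [Module.finrank_self, pow_one, smul_eq_mul] at this
    have h2 : ∀ t, ∫⁻ q : Vec d × Vec d, G (t, q) = ∫⁻ x : Vec d, ∫⁻ v : Vec d, G (t, x, v) := by
      intro t
      rw [Measure.volume_eq_prod, lintegral_prod _ (by fun_prop)]
    simpa only [h2] using this
  have hsplit : ∀ H : Phase d → ℝ≥0∞, Measurable H →
      ∫⁻ w, H w = ∫⁻ t : ℝ, ∫⁻ x : Vec d, ∫⁻ v : Vec d, H (t, x, v) := by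
    intro H hH
    rw [Measure.volume_eq_prod, lintegral_prod _ hH.aemeasurable]
    refine lintegral_congr fun t => ?_
    rw [Measure.volume_eq_prod, lintegral_prod _ (by fun_prop)]
  rw [hsplit _ hm, hsplit G hG]
  simp only [hv]
  have c1 : ∀ (c : ℝ) (F : ℝ → Vec d → ℝ≥0∞), ∫⁻ t, ∫⁻ x, ENNReal.ofReal c * F t x
      = ENNReal.ofReal c * ∫⁻ t, ∫⁻ x, F t x := by
    intro c F
    simp only [lintegral_const_mul' _ _ ENNReal.ofReal_ne_top]
  rw [c1]
  simp only [hx]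
  rw [lintegral_const_mul' _ _ ENNReal.ofReal_ne_top, ht, ← mul_assoc, ← mul_assoc,
    ← ENNReal.ofReal_mul (by positivity), ← ENNReal.ofReal_mul (by positivity)]
  congr 2
  rw [← mul_inv, ← mul_inv]
  congr 1
  rw [mul_pow]
  ring

/-- This is right translation by a fixed group element: a translation in t and in v, and for each v
a translation in x. The swap of x and v puts the shear in skew-product form. -/
theorem measurePreserving_kmap_left (a b : ℝ) (w : Phase d) :
    MeasurePreserving fun z : Phase d => kmap a b z w := by
  have h : MeasurePreserving (fun q : Vec d × Vec d =>
      (q.1 + ((a * b) • w.2.1 + (a * w.1) • q.2), q.2 + b • w.2.2)) := by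
    have h1 : MeasurePreserving (fun q : Vec d × Vec d =>
      (q.1 + b • w.2.2, q.2 + ((a * b) • w.2.1 + (a * w.1) • q.1))) := by
      refine MeasurePreserving.skew_product (g := fun v x =>
        x + ((a * b) • w.2.1 + (a * w.1) • v)) (measurePreserving_add_right volume _)
        (by fun_prop) (.of_forall fun v => ?_)
      exact (measurePreserving_add_right volume _).map_eq
    have hs : MeasurePreserving (Prod.swap : Vec d × Vec d → Vec d × Vec d) :=
      Measure.measurePreserving_swap
    exact (hs.comp h1).comp hs
  exact (measurePreserving_add_right (volume : Measure ℝ) (a * w.1)).prod h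

theorem map_kmap {a b : ℝ} (ha : 0 < a) (hb : 0 < b) (z : Phase d) :
    Measure.map (kmap a b z) volume
      = ENNReal.ofReal ((a ^ (1 + d) * b ^ (2 * d))⁻¹) • (volume : Measure (Phase d)) := by
  ext s hs
  have := lintegral_kmap ha hb z (G := s.indicator 1) (measurable_one.indicator hs)
  rw [lintegral_indicator_one hs] at this
  rw [Measure.smul_apply, smul_eq_mul, ← this, ← lintegral_indicator_one hs,
    lintegral_map (measurable_one.indicator hs) (measurable_kmap a b z)]

theorem integral_kmap {E : Type*} [NormedAddCommGroup E] [NormedSpace ℝ E]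
    {a b : ℝ} (ha : 0 < a) (hb : 0 < b) (z : Phase d) (u : Phase d → E) :
    ∫ w, u (kmap a b z w) = (a ^ (1 + d) * b ^ (2 * d))⁻¹ • ∫ y, u y := by
  have h : ∫ w, u (kmap a b z w) = ∫ y, u y ∂(Measure.map (kmap a b z) volume) :=
    ((kmapHomeo ha hb z).measurableEmbedding.integral_map u).symm
  rw [h, map_kmap ha hb, integral_smul_measure, ENNReal.toReal_ofReal (by positivity)]

/-! ### Exponential integrals, the layer cake formula and Hölder's inequality. -/

theorem lintegral_Iic_exp_mul {s : ℝ} (hs : 0 < s) (c : ℝ) :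
    ∫⁻ u in Set.Iic c, ENNReal.ofReal (Real.exp (s * u)) = ENNReal.ofReal (Real.exp (s * c) / s) := by
  rw [← integral_exp_mul_Iic hs c, ofReal_integral_eq_lintegral_ofReal
    (integrableOn_exp_mul_Iic hs _) (.of_forall fun _ => (Real.exp_pos _).le)]

theorem lintegral_Ioi_exp_neg_mul {s : ℝ} (hs : 0 < s) (c : ℝ) :
    ∫⁻ u in Set.Ioi c, ENNReal.ofReal (Real.exp (-s * u))
      = ENNReal.ofReal (Real.exp (-s * c) / s) := by
  rw [← ofReal_integral_eq_lintegral_ofReal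
    (integrableOn_exp_mul_Ioi (neg_lt_zero.2 hs) _) (.of_forall fun _ => (Real.exp_pos _).le),
    integral_exp_mul_Ioi (neg_lt_zero.2 hs) c, neg_div_neg_eq]

theorem lintegral_layer_ofReal {a : ℝ} (ha : 0 < a) {c : ℝ} (hc : 0 ≤ c) :
    ∫⁻ l in Set.Ioi (0 : ℝ), {l : ℝ | l < c}.indicator
      (fun l => ENNReal.ofReal (l ^ (a - 1))) l = ENNReal.ofReal (c ^ a / a) := by
  have h1 : MeasurableSet {l : ℝ | l < c} := measurableSet_Iio
  rw [lintegral_indicator h1, Measure.restrict_restrict h1]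
  have h2 : {l : ℝ | l < c} ∩ Set.Ioi 0 = Set.Ioo 0 c := by ext; simp [and_comm]
  rw [h2, restrict_Ioo_eq_restrict_Ioc]
  have hi := (intervalIntegral.intervalIntegrable_rpow' (a := 0) (b := c) (r := a - 1)
    (by linarith))
  rw [intervalIntegrable_iff_integrableOn_Ioc_of_le hc] at hi
  rw [← ofReal_integral_eq_lintegral_ofReal hi, ← intervalIntegral.integral_of_le hc,
    integral_rpow (Or.inl (by linarith))]
  · simp [Real.zero_rpow ha.ne']
  · filter_upwards [ae_restrict_mem measurableSet_Ioc] with x hx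
    exact Real.rpow_nonneg hx.1.le _

/-- The layer cake formula for powers of a single extended nonnegative number. -/
theorem lintegral_layer {a : ℝ} (ha : 0 < a) (h : ℝ≥0∞) :
    ∫⁻ l in Set.Ioi (0 : ℝ), {l : ℝ | ENNReal.ofReal l < h}.indicator
      (fun l => ENNReal.ofReal (l ^ (a - 1))) l = h ^ a / ENNReal.ofReal a := by
  have fin : ∀ c : ℝ≥0, ∫⁻ l in Set.Ioi (0 : ℝ), {l : ℝ | ENNReal.ofReal l < c}.indicator
      (fun l => ENNReal.ofReal (l ^ (a - 1))) l = (c : ℝ≥0∞) ^ a / ENNReal.ofReal a := by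
    intro c
    have := lintegral_layer_ofReal ha c.2
    rw [ENNReal.ofReal_div_of_pos ha, ← ENNReal.ofReal_rpow_of_nonneg c.2 ha.le] at this
    change _ = ENNReal.ofReal (c : ℝ) ^ a / _ at this
    rw [ENNReal.ofReal_coe_nnreal] at this
    rw [← this]
    refine setLIntegral_congr_fun measurableSet_Ioi fun l hl => ?_
    have : (ENNReal.ofReal l < c) ↔ (l < c) := by
      rw [← ENNReal.ofReal_coe_nnreal, ENNReal.ofReal_lt_ofReal_iff_of_nonneg (le_of_lt hl)]
    simp only [Set.indicator, Set.mem_ofPred_eq, this]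
    rfl
  induction h with
  | coe c => exact fin c
  | top =>
    rw [ENNReal.top_rpow_of_pos ha, ENNReal.top_div_of_ne_top ENNReal.ofReal_ne_top]
    -- By monotonicity the integral dominates the one with any finite bound c, and c is chosen so
    -- that c^a / a = r.
    refine ENNReal.eq_top_of_forall_nnreal_le fun r => ?_
    set c : ℝ≥0 := (r * a.toNNReal) ^ (1 / a) with hc
    have hc' : (c : ℝ≥0∞) ^ a / ENNReal.ofReal a = r := by
      rw [← ENNReal.coe_rpow_of_nonneg _ ha.le, hc, ← NNReal.rpow_mul, one_div,
        inv_mul_cancel₀ ha.ne', NNReal.rpow_one, ENNReal.coe_mul]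
      exact ENNReal.mul_div_cancel_right (by simpa using ha) ENNReal.coe_ne_top
    rw [← hc', ← fin c]
    refine lintegral_mono fun l => Set.indicator_le_indicator_of_subset ?_ (fun _ => zero_le) l
    exact fun l _ => ENNReal.ofReal_lt_top

theorem lintegral_le_lintegral_rpow_mul {W : Type*} [MeasurableSpace W] (ν : Measure W)
    {h : W → ℝ≥0∞} (hh : AEMeasurable h ν) {p : ℝ} (hp : 1 < p) :
    ∫⁻ w, h w ∂ν ≤ (∫⁻ w, h w ^ p ∂ν) ^ p⁻¹ * ν Set.univ ^ (1 - p⁻¹) := by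
  have hpq := Real.HolderConjugate.conjExponent hp
  have h1 := ENNReal.lintegral_mul_le_Lp_mul_Lq ν hpq (f := h) (g := 1) hh aemeasurable_const
  simp only [Pi.mul_apply, Pi.one_apply, mul_one, ENNReal.one_rpow, lintegral_const, one_mul] at h1
  have h2 : 1 / p.conjExponent = 1 - p⁻¹ := by
    rw [one_div]; linarith [hpq.inv_add_inv_eq_one]
  rwa [h2, one_div] at h1

/-! ### A Hardy–Littlewood–Sobolev inequality for averages over all scales. -/

section Potential

variable {X W : Type*} [MeasurableSpace X] [MeasurableSpace W] {μ : Measure X} {ν : Measure W}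

/-- A measurable family of averaging maps `Ψ u z : W → X`, measure preserving in `z` and with
Jacobian at least `exp u` in `w`. -/
structure IsAveragingFamily (μ : Measure X) (ν : Measure W) (Ψ : ℝ → X → W → X) : Prop where
  measurable : Measurable fun t : ℝ × X × W => Ψ t.1 t.2.1 t.2.2
  measurePreserving : ∀ u w, MeasurePreserving (fun z => Ψ u z w) μ μ
  lintegral_le : ∀ u z (G : X → ℝ≥0∞), Measurable G →
    ∫⁻ w, G (Ψ u z w) ∂ν ≤ ENNReal.ofReal (Real.exp (-u)) * ∫⁻ x, G x ∂μ

/-- The potential operator with density `exp (s u) du` in the scale parameter `u`. -/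
noncomputable def potential (ν : Measure W) (Ψ : ℝ → X → W → X) (s : ℝ) (G : X → ℝ≥0∞) (z : X) :
    ℝ≥0∞ :=
  ∫⁻ u, ENNReal.ofReal (Real.exp (s * u)) * ∫⁻ w, G (Ψ u z w) ∂ν

namespace IsAveragingFamily

variable {Ψ : ℝ → X → W → X}

theorem measurable_apply (h : IsAveragingFamily μ ν Ψ) (u : ℝ) (z : X) : Measurable (Ψ u z) :=
  h.measurable.comp (measurable_const.prodMk (measurable_const.prodMk measurable_id))

theorem measurable_average [SFinite ν] (h : IsAveragingFamily μ ν Ψ) {G : X → ℝ≥0∞}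
    (hG : Measurable G) : Measurable fun t : ℝ × X => ∫⁻ w, G (Ψ t.1 t.2 w) ∂ν :=
  Measurable.lintegral_prod_right' (f := fun r : (ℝ × X) × W => G (Ψ r.1.1 r.1.2 r.2))
    (hG.comp (h.measurable.comp (by fun_prop : Measurable fun r : (ℝ × X) × W =>
      (r.1.1, r.1.2, r.2))))

theorem measurable_integrand [SFinite ν] (h : IsAveragingFamily μ ν Ψ) {G : X → ℝ≥0∞}
    (hG : Measurable G) (s : ℝ) : Measurable fun t : ℝ × X =>
      ENNReal.ofReal (Real.exp (s * t.1)) * ∫⁻ w, G (Ψ t.1 t.2 w) ∂ν :=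
  Measurable.mul (by fun_prop) (h.measurable_average hG)

theorem measurable_potential [SFinite ν] (h : IsAveragingFamily μ ν Ψ) {G : X → ℝ≥0∞}
    (hG : Measurable G) (s : ℝ) : Measurable (potential ν Ψ s G) :=
  Measurable.lintegral_prod_left' (h.measurable_integrand hG s)

theorem lintegral_average [SFinite μ] [SFinite ν] (h : IsAveragingFamily μ ν Ψ) {G : X → ℝ≥0∞}
    (hG : Measurable G) (u : ℝ) :
    ∫⁻ z, ∫⁻ w, G (Ψ u z w) ∂ν ∂μ = ν Set.univ * ∫⁻ x, G x ∂μ := by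
  rw [lintegral_lintegral_swap]
  · simp only [(h.measurePreserving u _).lintegral_comp hG, lintegral_const, mul_comm]
  · exact (hG.comp (h.measurable.comp (by fun_prop : Measurable fun r : X × W =>
      (u, r.1, r.2)))).aemeasurable

/-- Hölder in w produces the L^p norm of G along the averaging map; the Jacobian bound then yields
the decay e^{-u/p} at large scales. -/
theorem average_le_rpow (h : IsAveragingFamily μ ν Ψ) {G : X → ℝ≥0∞} (hG : Measurable G)
    {p : ℝ} (hp : 1 < p) (u : ℝ) (z : X) :
    ∫⁻ w, G (Ψ u z w) ∂ν ≤ ENNReal.ofReal (Real.exp (-p⁻¹ * u)) * (∫⁻ x, G x ^ p ∂μ) ^ p⁻¹ *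
      ν Set.univ ^ (1 - p⁻¹) := by
  have h1 := lintegral_le_lintegral_rpow_mul ν (hG.comp (h.measurable_apply u z)).aemeasurable hp
  refine h1.trans ?_
  gcongr
  refine (ENNReal.rpow_le_rpow (h.lintegral_le u z _ (hG.pow_const p)) (by positivity)).trans ?_
  rw [ENNReal.mul_rpow_of_nonneg _ _ (by positivity), ENNReal.ofReal_rpow_of_pos (Real.exp_pos _),
    ← Real.exp_mul]
  apply le_of_eq
  congr 3
  ring

/-- Distributional estimate: the part of the potential from large scales is bounded by Hölder's
inequality, the part from small values of `G` by its maximum, and Markov's inequality is applied to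
the rest. -/
theorem measure_lt_potential_le [SFinite μ] [IsFiniteMeasure ν] (h : IsAveragingFamily μ ν Ψ)
    {G : X → ℝ≥0∞} (hG : Measurable G) {s p q b c₀ : ℝ} (hs : 0 < s) (hp : 1 < p) (hq : 0 < q)
    (hpq : q⁻¹ = p⁻¹ - s) (hG1 : ∫⁻ x, G x ^ p ∂μ ≤ 1) (hb : 0 ≤ b)
    (hνb : ν Set.univ ≤ ENNReal.ofReal b) (hc₀ : 0 ≤ c₀)
    (hνc : ν Set.univ ^ (1 - p⁻¹) ≤ ENNReal.ofReal c₀) {l u₀ γ : ℝ} (hl : 0 < l) (hγ : 0 ≤ γ)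
    (h1 : c₀ * (q * Real.exp (-q⁻¹ * u₀)) ≤ l / 3)
    (h2 : γ * b * (Real.exp (s * u₀) / s) ≤ l / 3) :
    μ {z | ENNReal.ofReal l < potential ν Ψ s G z} ≤
      ENNReal.ofReal (3 / l * (b * (Real.exp (s * u₀) / s))) *
        ∫⁻ x, {x | ENNReal.ofReal γ < G x}.indicator G x ∂μ := by
  set G₁ := {x | ENNReal.ofReal γ < G x}.indicator G with hG₁
  have hG₁m : Measurable G₁ := hG.indicator (measurableSet_lt measurable_const hG)
  set Y : X → ℝ≥0∞ := fun z => ∫⁻ u in Set.Iic u₀, ENNReal.ofReal (Real.exp (s * u)) *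
    ∫⁻ w, G₁ (Ψ u z w) ∂ν with hY
  have hYm : Measurable Y := Measurable.lintegral_prod_left' (h.measurable_integrand hG₁m s)
  -- Above u₀ the weight e^{su} meets the decay e^{-u/p}, leaving the integrable e^{-u/q}.
  have tail : ∀ z, ∫⁻ u in Set.Ioi u₀, ENNReal.ofReal (Real.exp (s * u)) *
      ∫⁻ w, G (Ψ u z w) ∂ν ≤ ENNReal.ofReal (l / 3) := by
    intro z
    calc _ ≤ ∫⁻ u in Set.Ioi u₀, ENNReal.ofReal c₀ * ENNReal.ofReal (Real.exp (-q⁻¹ * u)) := by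
          refine lintegral_mono fun u => ?_
          have h3 := h.average_le_rpow hG hp u z
          have h4 : (∫⁻ x, G x ^ p ∂μ) ^ p⁻¹ ≤ 1 := ENNReal.rpow_le_one hG1 (by positivity)
          calc _ ≤ ENNReal.ofReal (Real.exp (s * u)) *
                (ENNReal.ofReal (Real.exp (-p⁻¹ * u)) * 1 * ENNReal.ofReal c₀) := by
                gcongr
                exact h3.trans (by gcongr)
            _ = _ := by
                rw [mul_one, ← mul_assoc, ← ENNReal.ofReal_mul (Real.exp_pos _).le, ← Real.exp_add,
                  mul_comm]
                congr 3
                rw [hpq]; ring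
      _ = ENNReal.ofReal (c₀ * (q * Real.exp (-q⁻¹ * u₀))) := by
          rw [lintegral_const_mul' _ _ ENNReal.ofReal_ne_top,
            lintegral_Ioi_exp_neg_mul (inv_pos.2 hq), ← ENNReal.ofReal_mul hc₀]
          congr 2
          field_simp
      _ ≤ _ := ENNReal.ofReal_le_ofReal h1
  have head : ∀ z, ∫⁻ u in Set.Iic u₀, ENNReal.ofReal (Real.exp (s * u)) *
      ∫⁻ w, G (Ψ u z w) ∂ν ≤ ENNReal.ofReal (l / 3) + Y z := by
    intro z
    calc _ ≤ ∫⁻ u in Set.Iic u₀, (ENNReal.ofReal (γ * b) * ENNReal.ofReal (Real.exp (s * u)) +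
            ENNReal.ofReal (Real.exp (s * u)) * ∫⁻ w, G₁ (Ψ u z w) ∂ν) := by
          refine lintegral_mono fun u => ?_
          dsimp only
          rw [mul_comm (ENNReal.ofReal (γ * b)), ← mul_add]
          gcongr
          calc ∫⁻ w, G (Ψ u z w) ∂ν ≤ ∫⁻ w, (ENNReal.ofReal γ + G₁ (Ψ u z w)) ∂ν := by
                refine lintegral_mono fun w => ?_
                by_cases hw : ENNReal.ofReal γ < G (Ψ u z w)
                · rw [hG₁, Set.indicator_of_mem (show Ψ u z w ∈ {x | ENNReal.ofReal γ < G x} from hw)]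
                  exact le_add_self
                · exact (not_lt.1 hw).trans le_self_add
            _ ≤ _ := by
                rw [lintegral_add_left measurable_const, lintegral_const, ENNReal.ofReal_mul hγ]
                gcongr
      _ = ENNReal.ofReal (γ * b * (Real.exp (s * u₀) / s)) + Y z := by
          rw [lintegral_add_left (by fun_prop), lintegral_const_mul' _ _ ENNReal.ofReal_ne_top,
            lintegral_Iic_exp_mul hs, ← ENNReal.ofReal_mul (by positivity)]
      _ ≤ _ := by gcongr
  -- The large scales and the values of G below γ contribute at most l/3 each, so the remaining part
  -- Y must reach l/3.
  have hsub : {z | ENNReal.ofReal l < potential ν Ψ s G z} ⊆ {z | ENNReal.ofReal (l / 3) ≤ Y z} := by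
    intro z hz
    by_contra hcon
    simp only [Set.mem_ofPred_eq, not_le] at hz hcon
    refine hz.not_ge ?_
    rw [potential, ← lintegral_add_compl _ (measurableSet_Iic (a := u₀)), Set.compl_Iic]
    calc _ ≤ ENNReal.ofReal (l / 3) + ENNReal.ofReal (l / 3) + ENNReal.ofReal (l / 3) :=
          add_le_add ((head z).trans (by gcongr)) (tail z)
      _ = ENNReal.ofReal l := by
          rw [← ENNReal.ofReal_add (by positivity) (by positivity),
            ← ENNReal.ofReal_add (by positivity) (by positivity)]
          congr 1; ring
  have hYint : ∫⁻ z, Y z ∂μ ≤ ENNReal.ofReal (b * (Real.exp (s * u₀) / s)) * ∫⁻ x, G₁ x ∂μ := by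
    calc ∫⁻ z, Y z ∂μ = ∫⁻ u in Set.Iic u₀, ∫⁻ z, ENNReal.ofReal (Real.exp (s * u)) *
            ∫⁻ w, G₁ (Ψ u z w) ∂ν ∂μ :=
          lintegral_lintegral_swap
            (((h.measurable_integrand hG₁m s).comp measurable_swap).aemeasurable)
      _ = ∫⁻ u in Set.Iic u₀, (ν Set.univ * ∫⁻ x, G₁ x ∂μ) * ENNReal.ofReal (Real.exp (s * u)) := by
          refine lintegral_congr fun u => ?_
          rw [lintegral_const_mul' _ _ ENNReal.ofReal_ne_top, h.lintegral_average hG₁m, mul_comm]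
      _ = (ν Set.univ * ∫⁻ x, G₁ x ∂μ) * ENNReal.ofReal (Real.exp (s * u₀) / s) := by
          rw [lintegral_const_mul _ (by fun_prop), lintegral_Iic_exp_mul hs]
      _ ≤ (ENNReal.ofReal b * ∫⁻ x, G₁ x ∂μ) * ENNReal.ofReal (Real.exp (s * u₀) / s) := by
          gcongr
      _ = _ := by
          rw [ENNReal.ofReal_mul hb]; ring
  calc _ ≤ μ {z | ENNReal.ofReal (l / 3) ≤ Y z} := measure_mono hsub
    _ ≤ (∫⁻ z, Y z ∂μ) / ENNReal.ofReal (l / 3) :=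
        meas_ge_le_lintegral_div hYm.aemeasurable (by simpa using hl) ENNReal.ofReal_ne_top
    _ ≤ (ENNReal.ofReal (b * (Real.exp (s * u₀) / s)) * ∫⁻ x, G₁ x ∂μ) / ENNReal.ofReal (l / 3) := by
        gcongr
    _ = _ := by
        rw [ENNReal.div_eq_inv_mul, ← ENNReal.ofReal_inv_of_pos (by positivity), ← mul_assoc,
          ← ENNReal.ofReal_mul (by positivity), inv_div]

/-- The cut-offs u₀ and γ in the distributional estimate are adapted to each level l. Because the
bound keeps only the values of G above γ(l), integrating it against q l^{q-1} dl gives the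
strong-type estimate directly, without interpolation. -/
theorem lintegral_potential_rpow_le [SFinite μ] [IsFiniteMeasure ν] {s p q : ℝ} (hs : 0 < s)
    (hp : 1 < p) (hq : 0 < q) (hpq : q⁻¹ = p⁻¹ - s) :
    ∃ K : ℝ≥0∞, K ≠ ⊤ ∧ ∀ Ψ : ℝ → X → W → X, IsAveragingFamily μ ν Ψ →
      ∀ G : X → ℝ≥0∞, Measurable G → ∫⁻ x, G x ^ p ∂μ ≤ 1 →
        ∫⁻ z, potential ν Ψ s G z ^ q ∂μ ≤ K := by
  have hp0 : 0 < p := by linarith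
  set b : ℝ := (ν Set.univ).toReal + 1 with hb
  have hb0 : 0 < b := by positivity
  have hνb : ν Set.univ ≤ ENNReal.ofReal b := by
    rw [← ENNReal.ofReal_toReal (measure_ne_top ν Set.univ)]
    exact ENNReal.ofReal_le_ofReal (by linarith)
  set c₀ : ℝ := b ^ (1 - p⁻¹) with hc₀
  have hc₀0 : 0 < c₀ := by positivity
  have hp1 : 0 ≤ 1 - p⁻¹ := by
    rw [sub_nonneg]; exact inv_le_one_of_one_le₀ hp.le
  have hνc : ν Set.univ ^ (1 - p⁻¹) ≤ ENNReal.ofReal c₀ := by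
    rw [hc₀, ← ENNReal.ofReal_rpow_of_pos hb0]
    exact ENNReal.rpow_le_rpow hνb hp1
  -- With e^{u₀} = k₁ l^{-q} and γ = k₂ l^{q/p}, these constants make both the tail and the
  -- truncated part equal to l/3.
  set k₁ : ℝ := (3 * c₀ * q) ^ q with hk₁
  have hk₁0 : 0 < k₁ := by positivity
  set k₂ : ℝ := s / (3 * b * k₁ ^ s) with hk₂
  have hk₂0 : 0 < k₂ := by positivity
  have hexp : 1 + q * s = q / p := by
    have : q * q⁻¹ = q * (p⁻¹ - s) := by rw [hpq]
    rw [mul_inv_cancel₀ hq.ne'] at this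
    rw [this, div_eq_mul_inv]; ring
  have hr : 0 < q - q / p := by
    have : q / p < q := div_lt_self hq hp
    linarith
  refine ⟨ENNReal.ofReal q * (ENNReal.ofReal k₂⁻¹ * (ENNReal.ofReal (k₂⁻¹ ^ (p - 1)) /
    ENNReal.ofReal (q - q / p))), ?_, fun Ψ h G hG hG1 => ?_⟩
  · refine ENNReal.mul_ne_top ENNReal.ofReal_ne_top (ENNReal.mul_ne_top ENNReal.ofReal_ne_top ?_)
    exact ENNReal.div_ne_top ENNReal.ofReal_ne_top (by simpa using hr)
  have level : ∀ l : ℝ, 0 < l → μ {z | ENNReal.ofReal l < potential ν Ψ s G z} ≤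
      ENNReal.ofReal (k₂⁻¹ * l ^ (-(q / p))) *
        ∫⁻ x, {x | ENNReal.ofReal (k₂ * l ^ (q / p)) < G x}.indicator G x ∂μ := by
    intro l hl
    set u₀ : ℝ := Real.log (k₁ * l ^ (-q)) with hu₀
    have hE : ∀ r : ℝ, Real.exp (r * u₀) = k₁ ^ r * l ^ (-(q * r)) := by
      intro r
      rw [hu₀, mul_comm, ← Real.rpow_def_of_pos (by positivity),
        Real.mul_rpow hk₁0.le (by positivity), ← Real.rpow_mul hl.le, neg_mul]
    have hEs : b * (Real.exp (s * u₀) / s) = (k₂⁻¹ / 3) * l ^ (-(q * s)) := by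
      rw [hE, hk₂]; field_simp
    have key := h.measure_lt_potential_le hG hs hp hq hpq hG1 hb0.le hνb hc₀0.le hνc (l := l)
      (u₀ := u₀) (γ := k₂ * l ^ (q / p)) hl (by positivity) ?_ ?_
    · refine key.trans (le_of_eq ?_)
      congr 2
      rw [hEs, ← hexp, neg_add, Real.rpow_add hl, Real.rpow_neg_one]
      field_simp
    · rw [hE, hk₁, ← Real.rpow_mul (by positivity)]
      have e1 : q * -q⁻¹ = -1 := by field_simp
      rw [e1, Real.rpow_neg_one, neg_neg, Real.rpow_one]
      apply le_of_eq; field_simp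
    · have : k₂ * l ^ (q / p) * b * (Real.exp (s * u₀) / s)
          = k₂ * l ^ (q / p) * (b * (Real.exp (s * u₀) / s)) := by ring
      rw [this, hEs, ← hexp, Real.rpow_add hl, Real.rpow_one, Real.rpow_neg hl.le]
      apply le_of_eq; field_simp
  have hImeas := h.measurable_potential hG s
  have hq' : ENNReal.ofReal q ≠ 0 := by simpa using hq
  have step1 : ∫⁻ z, potential ν Ψ s G z ^ q ∂μ = ENNReal.ofReal q *
      ∫⁻ l in Set.Ioi (0 : ℝ), ENNReal.ofReal (l ^ (q - 1)) *
        μ {z | ENNReal.ofReal l < potential ν Ψ s G z} := by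
    have e1 : ∀ z, potential ν Ψ s G z ^ q = ENNReal.ofReal q *
        ∫⁻ l in Set.Ioi (0 : ℝ), {l : ℝ | ENNReal.ofReal l < potential ν Ψ s G z}.indicator
          (fun l => ENNReal.ofReal (l ^ (q - 1))) l := by
      intro z
      rw [lintegral_layer hq, ENNReal.mul_div_cancel hq' ENNReal.ofReal_ne_top]
    have hmS : MeasurableSet {t : X × ℝ | ENNReal.ofReal t.2 < potential ν Ψ s G t.1} :=
      measurableSet_lt (by fun_prop) (hImeas.comp measurable_fst)
    simp only [e1]
    rw [lintegral_const_mul' _ _ ENNReal.ofReal_ne_top, lintegral_lintegral_swap]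
    · congr 1
      refine lintegral_congr fun l => ?_
      have : ∀ z, {l : ℝ | ENNReal.ofReal l < potential ν Ψ s G z}.indicator
          (fun l => ENNReal.ofReal (l ^ (q - 1))) l =
          {z | ENNReal.ofReal l < potential ν Ψ s G z}.indicator
            (fun _ => ENNReal.ofReal (l ^ (q - 1))) z := fun z => rfl
      simp only [this]
      rw [lintegral_indicator_const (measurableSet_lt measurable_const hImeas)]
    · exact (Measurable.indicator (f := fun t : X × ℝ => ENNReal.ofReal (t.2 ^ (q - 1)))
        (by fun_prop) hmS).aemeasurable
  have step2 : ∫⁻ l in Set.Ioi (0 : ℝ), ENNReal.ofReal (l ^ (q - 1)) *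
        μ {z | ENNReal.ofReal l < potential ν Ψ s G z} ≤ ENNReal.ofReal k₂⁻¹ *
      ∫⁻ l in Set.Ioi (0 : ℝ), ∫⁻ x, ENNReal.ofReal (l ^ (q - q / p - 1)) *
        {x | ENNReal.ofReal (k₂ * l ^ (q / p)) < G x}.indicator G x ∂μ := by
    rw [← lintegral_const_mul' _ _ ENNReal.ofReal_ne_top]
    refine setLIntegral_mono' measurableSet_Ioi fun l hl => ?_
    have hl' : 0 < l := hl
    refine (mul_le_mul_right (level l hl) _).trans (le_of_eq ?_)
    rw [lintegral_const_mul' _ _ ENNReal.ofReal_ne_top, ← mul_assoc, ← mul_assoc,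
      ← ENNReal.ofReal_mul (by positivity), ← ENNReal.ofReal_mul (by positivity)]
    congr 2
    rw [mul_left_comm, ← Real.rpow_add hl']
    congr 2; ring
  have step3 : ∫⁻ l in Set.Ioi (0 : ℝ), ∫⁻ x, ENNReal.ofReal (l ^ (q - q / p - 1)) *
        {x | ENNReal.ofReal (k₂ * l ^ (q / p)) < G x}.indicator G x ∂μ ≤
      ENNReal.ofReal (k₂⁻¹ ^ (p - 1)) / ENNReal.ofReal (q - q / p) := by
    rw [lintegral_lintegral_swap]
    · calc _ ≤ ∫⁻ x, (ENNReal.ofReal (k₂⁻¹ ^ (p - 1)) / ENNReal.ofReal (q - q / p)) * G x ^ p ∂μ := by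
            refine lintegral_mono fun x => ?_
            -- The condition k₂ l^{q/p} < G(x) on the level, solved for l, reads l < y; the
            -- l-integral is then a layer cake of exponent q - q/p.
            set y : ℝ≥0∞ := (ENNReal.ofReal k₂⁻¹ * G x) ^ (p / q) with hy
            calc _ ≤ ∫⁻ l in Set.Ioi (0 : ℝ), G x * {l : ℝ | ENNReal.ofReal l < y}.indicator
                    (fun l => ENNReal.ofReal (l ^ (q - q / p - 1))) l := by
                  refine setLIntegral_mono' measurableSet_Ioi fun l hl => ?_
                  have hl' : 0 < l := hl
                  by_cases hc : ENNReal.ofReal (k₂ * l ^ (q / p)) < G x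
                  · have hly : ENNReal.ofReal l < y := by
                      have e : ENNReal.ofReal l =
                          (ENNReal.ofReal k₂⁻¹ * ENNReal.ofReal (k₂ * l ^ (q / p))) ^ (p / q) := by
                        rw [← ENNReal.ofReal_mul (by positivity), inv_mul_cancel_left₀ hk₂0.ne',
                          ENNReal.ofReal_rpow_of_pos (by positivity), ← Real.rpow_mul hl'.le]
                        have : q / p * (p / q) = 1 := by field_simp
                        rw [this, Real.rpow_one]
                      rw [e, hy]
                      refine ENNReal.rpow_lt_rpow ?_ (by positivity)
                      refine ENNReal.mul_lt_mul_right ?_ ENNReal.ofReal_ne_top hc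
                      simpa using hk₂0
                    rw [Set.indicator_of_mem (show x ∈ {x | ENNReal.ofReal (k₂ * l ^ (q / p)) < G x} from hc),
                      Set.indicator_of_mem (show l ∈ {l : ℝ | ENNReal.ofReal l < y} from hly), mul_comm]
                  · rw [Set.indicator_of_notMem (show x ∉ {x | ENNReal.ofReal (k₂ * l ^ (q / p)) < G x} from hc), mul_zero]
                    exact zero_le
              _ = G x * (y ^ (q - q / p) / ENNReal.ofReal (q - q / p)) := by
                  rw [lintegral_const_mul, lintegral_layer hr]
                  exact Measurable.indicator (by fun_prop)
                    (measurableSet_lt (by fun_prop) measurable_const)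
              _ = _ := by
                  have e2 : p / q * (q - q / p) = p - 1 := by field_simp
                  have e3 : G x ^ p = G x * G x ^ (p - 1) := by
                    nth_rw 2 [← ENNReal.rpow_one (G x)]
                    rw [← ENNReal.rpow_add_of_nonneg _ _ (by norm_num) (by linarith)]
                    congr 1; ring
                  rw [hy, ← ENNReal.rpow_mul, e2, ENNReal.mul_rpow_of_nonneg _ _ (by linarith),
                    ENNReal.ofReal_rpow_of_pos (by positivity), e3]
                  simp only [div_eq_mul_inv]
                  ring
        _ ≤ _ := by
            rw [lintegral_const_mul _ (hG.pow_const p)]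
            exact mul_le_of_le_one_right zero_le hG1
    · refine Measurable.aemeasurable (Measurable.mul (by fun_prop) ?_)
      exact Measurable.indicator (f := fun t : ℝ × X => G t.2) (hG.comp measurable_snd)
        (measurableSet_lt (f := fun t : ℝ × X => ENNReal.ofReal (k₂ * t.1 ^ (q / p)))
          (by fun_prop) (hG.comp measurable_snd))
  rw [step1]
  gcongr
  exact step2.trans (by gcongr)

/-- The Hardy–Littlewood–Sobolev inequality for the potential of an averaging family. -/
theorem potential_norm_le [SFinite μ] [IsFiniteMeasure ν] {s p q : ℝ} (hs : 0 < s)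
    (hp : 1 < p) (hq : 0 < q) (hpq : q⁻¹ = p⁻¹ - s) :
    ∃ K : ℝ≥0∞, K ≠ ⊤ ∧ ∀ Ψ : ℝ → X → W → X, IsAveragingFamily μ ν Ψ →
      ∀ G : X → ℝ≥0∞, Measurable G → ∫⁻ x, G x ^ p ∂μ ≠ ⊤ →
        (∫⁻ z, potential ν Ψ s G z ^ q ∂μ) ^ q⁻¹ ≤ K * (∫⁻ x, G x ^ p ∂μ) ^ p⁻¹ := by
  have hp0 : 0 < p := by linarith
  obtain ⟨K, hK, H⟩ := lintegral_potential_rpow_le (μ := μ) (ν := ν) hs hp hq hpq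
  refine ⟨K ^ q⁻¹, ENNReal.rpow_ne_top_of_nonneg (by positivity) hK, fun Ψ h G hG hfin => ?_⟩
  set N : ℝ≥0∞ := (∫⁻ x, G x ^ p ∂μ) ^ p⁻¹ with hN
  have hNfin : N ≠ ⊤ := ENNReal.rpow_ne_top_of_nonneg (by positivity) hfin
  have hNp : N ^ p = ∫⁻ x, G x ^ p ∂μ := by
    rw [hN, ← ENNReal.rpow_mul, inv_mul_cancel₀ hp0.ne', ENNReal.rpow_one]
  have scale : ∀ c : ℝ≥0∞, c ≠ ⊤ → ∀ z, potential ν Ψ s (fun x => c * G x) z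
      = c * potential ν Ψ s G z := by
    intro c hc z
    unfold potential
    simp only [lintegral_const_mul' _ _ hc]
    rw [← lintegral_const_mul' _ _ hc]
    refine lintegral_congr fun u => ?_
    ring
  have bound : ∀ c : ℝ≥0∞, c ≠ ⊤ → c * N ≤ 1 →
      c * (∫⁻ z, potential ν Ψ s G z ^ q ∂μ) ^ q⁻¹ ≤ K ^ q⁻¹ := by
    intro c hc hcN
    have h1 := H Ψ h (fun x => c * G x) (hG.const_mul c) (by
      simp only [ENNReal.mul_rpow_of_nonneg _ _ hp0.le]
      rw [lintegral_const_mul' _ _ (ENNReal.rpow_ne_top_of_nonneg hp0.le hc), ← hNp,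
        ← ENNReal.mul_rpow_of_nonneg _ _ hp0.le]
      exact ENNReal.rpow_le_one hcN hp0.le)
    simp only [scale c hc, ENNReal.mul_rpow_of_nonneg _ _ hq.le] at h1
    rw [lintegral_const_mul' _ _ (ENNReal.rpow_ne_top_of_nonneg hq.le hc)] at h1
    have h2 := ENNReal.rpow_le_rpow h1 (inv_nonneg.2 hq.le)
    rwa [ENNReal.mul_rpow_of_nonneg _ _ (inv_nonneg.2 hq.le), ← ENNReal.rpow_mul,
      mul_inv_cancel₀ hq.ne', ENNReal.rpow_one] at h2
  -- When N vanishes, every multiple of G satisfies the normalisation, so all integer multiples of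
  -- the left side stay bounded and it must be zero.
  by_cases hN0 : N = 0
  · rw [hN0, mul_zero, nonpos_iff_eq_zero]
    by_contra hne
    have : ∀ n : ℕ, n * (∫⁻ z, potential ν Ψ s G z ^ q ∂μ) ^ q⁻¹ ≤ K ^ q⁻¹ := fun n =>
      bound n (ENNReal.natCast_ne_top n) (by simp [hN0])
    obtain ⟨n, hn⟩ := ENNReal.exists_nat_mul_gt hne
      (ENNReal.rpow_ne_top_of_nonneg (inv_nonneg.2 hq.le) hK)
    exact (this n).not_gt hn
  · have := bound N⁻¹ (ENNReal.inv_ne_top.2 hN0) (ENNReal.inv_mul_cancel hN0 hNfin).le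
    calc _ = N * (N⁻¹ * (∫⁻ z, potential ν Ψ s G z ^ q ∂μ) ^ q⁻¹) := by
          rw [← mul_assoc, ENNReal.mul_inv_cancel hN0 hNfin, one_mul]
      _ ≤ N * K ^ q⁻¹ := by gcongr
      _ = _ := mul_comm _ _

end IsAveragingFamily

end Potential

/-! ### Calculus of test functions under the kinetic derivatives. -/

theorem inner_velGrad {φ : Phase d → ℝ} {z : Phase d} (h : DifferentiableAt ℝ φ z) (e : Vec d) :
    inner ℝ e (velGrad φ z) = fderiv ℝ φ z (0, 0, e) := by
  have h1 : HasFDerivAt (fun w : Vec d => ((z.1, z.2.1, w) : Phase d))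
      ((0 : Vec d →L[ℝ] ℝ).prod ((0 : Vec d →L[ℝ] Vec d).prod (.id ℝ (Vec d)))) z.2.2 :=
    (hasFDerivAt_const _ _).prodMk ((hasFDerivAt_const _ _).prodMk (hasFDerivAt_id _))
  have h2 := HasFDerivAt.comp (g := φ) z.2.2 (h.hasFDerivAt) h1
  rw [velGrad, real_inner_comm, gradient, InnerProductSpace.toDual_symm_apply]
  have h3 := h2.fderiv
  simp only [Function.comp_def] at h3
  rw [h3]
  rfl

theorem velGrad_apply {φ : Phase d → ℝ} {z : Phase d} (h : DifferentiableAt ℝ φ z) (i : Fin d) :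
    velGrad φ z i = fderiv ℝ φ z (0, 0, EuclideanSpace.single i 1) := by
  rw [← inner_velGrad h]
  simp [EuclideanSpace.inner_single_left]

theorem transport_eq {φ : Phase d → ℝ} {z : Phase d} (h : DifferentiableAt ℝ φ z) :
    transport φ z = fderiv ℝ φ z (1, z.2.2, 0) := by
  have h1 : HasFDerivAt (fun w : Vec d => ((z.1, w, z.2.2) : Phase d))
      ((0 : Vec d →L[ℝ] ℝ).prod ((.id ℝ (Vec d) : Vec d →L[ℝ] Vec d).prod 0)) z.2.1 :=
    (hasFDerivAt_const _ _).prodMk ((hasFDerivAt_id _).prodMk (hasFDerivAt_const _ _))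
  have h2 := HasFDerivAt.comp (g := φ) z.2.1 (h.hasFDerivAt) h1
  have h3 := h2.fderiv
  have k1 : HasDerivAt (fun s : ℝ => ((s, z.2.1, z.2.2) : Phase d)) (1, 0, 0) z.1 :=
    (hasDerivAt_id _).prodMk ((hasDerivAt_const _ _).prodMk (hasDerivAt_const _ _))
  have k2 := (HasFDerivAt.comp_hasDerivAt (l := φ) z.1 (h.hasFDerivAt) k1).deriv
  simp only [Function.comp_def] at h3 k2
  rw [transport, real_inner_comm, gradient, InnerProductSpace.toDual_symm_apply, h3, k2]
  have : ((1, z.2.2, 0) : Phase d) = (1, 0, 0) + (0, z.2.2, 0) := by simp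
  rw [this, map_add]
  rfl

namespace IsTest

variable {φ ψ : Phase d → ℝ}

theorem differentiable (h : IsTest φ) : Differentiable ℝ φ := h.1.differentiable (by simp)

theorem contDiff_mul {u : Phase d → ℝ} (hu : ContDiff ℝ ∞ u) (h : IsTest φ) :
    IsTest fun z => u z * φ z :=
  ⟨hu.mul h.1, h.2.mul_left⟩

theorem add (h : IsTest φ) (h' : IsTest ψ) : IsTest fun z => φ z + ψ z :=
  ⟨h.1.add h'.1, h.2.add h'.2⟩

theorem sub (h : IsTest φ) (h' : IsTest ψ) : IsTest fun z => φ z - ψ z :=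
  ⟨h.1.sub h'.1, h.2.sub h'.2⟩

theorem sum {ι : Type*} (s : Finset ι) {φ : ι → Phase d → ℝ} (h : ∀ i ∈ s, IsTest (φ i)) :
    IsTest fun z => ∑ i ∈ s, φ i z := by
  classical
  induction s using Finset.induction_on with
  | empty =>
    simp only [Finset.sum_empty]
    exact ⟨contDiff_const, HasCompactSupport.zero⟩
  | insert i s hi ih =>
    simp only [Finset.sum_insert hi]
    exact (h i (by simp)).add (ih fun j hj => h j (by simp [hj]))

theorem fderiv_apply (h : IsTest φ) {X : Phase d → Phase d} (hX : ContDiff ℝ ∞ X) :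
    IsTest fun z => fderiv ℝ φ z (X z) := by
  refine ⟨(h.1.fderiv_right (m := ∞) (by simp)).clm_apply hX, ?_⟩
  refine h.2.mono' fun z hz => ?_
  by_contra hcon
  refine hz ?_
  have := fderiv_of_notMem_tsupport (𝕜 := ℝ) hcon
  simp [this]

theorem velGrad_apply_eq (h : IsTest φ) (i : Fin d) : (fun z => velGrad φ z i) =
    fun z => fderiv ℝ φ z (0, 0, EuclideanSpace.single i 1) :=
  funext fun _ => velGrad_apply (h.differentiable _) i

theorem transport_eq_fun (h : IsTest φ) :
    transport φ = fun z => fderiv ℝ φ z (1, z.2.2, 0) :=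
  funext fun _ => transport_eq (h.differentiable _)

theorem velGrad (h : IsTest φ) (i : Fin d) : IsTest fun z => velGrad φ z i := by
  rw [h.velGrad_apply_eq]
  exact h.fderiv_apply contDiff_const

theorem transport (h : IsTest φ) : IsTest (transport φ) := by
  rw [h.transport_eq_fun]
  exact h.fderiv_apply (by fun_prop)

theorem comp_kinv (h : IsTest φ) {a b : ℝ} (ha : 0 < a) (hb : 0 < b) (z : Phase d) :
    IsTest fun y => φ (kinv a b z y) :=
  ⟨h.1.comp (contDiff_kinv a b z), h.2.comp_homeomorph (kmapHomeo ha hb z).symm⟩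

end IsTest

/-- Only the image of one line matters. `kinv` maps the lines along ∂_v and along T to lines again,
so its full derivative is never needed. -/
theorem fderiv_comp_of_line {E F : Type*} [NormedAddCommGroup E] [NormedSpace ℝ E]
    [NormedAddCommGroup F] [NormedSpace ℝ F] {h : F → ℝ} {k : E → F} {y e : E} {e' : F}
    (hh : DifferentiableAt ℝ h (k y)) (hk : DifferentiableAt ℝ k y)
    (hl : ∀ t : ℝ, k (y + t • e) = k y + t • e') :
    fderiv ℝ (fun y => h (k y)) y e = fderiv ℝ h (k y) e' := by
  have h1 : DifferentiableAt ℝ (fun y => h (k y)) y := hh.comp y hk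
  rw [← h1.lineDeriv_eq_fderiv, ← hh.lineDeriv_eq_fderiv]
  simp only [lineDeriv, hl]

theorem inner_velGrad_comp_kinv {φ : Phase d → ℝ} (h : IsTest φ) {a b : ℝ} (ha : 0 < a)
    (hb : 0 < b) (z y : Phase d) (e : Vec d) :
    inner ℝ e (velGrad (fun y => φ (kinv a b z y)) y)
      = b⁻¹ * inner ℝ e (velGrad φ (kinv a b z y)) := by
  have hk := (contDiff_kinv a b z).differentiable (by simp)
  rw [inner_velGrad ((h.comp_kinv ha hb z).differentiable y), inner_velGrad (h.differentiable _),
    fderiv_comp_of_line (e' := b⁻¹ • (0, 0, e)) (h.differentiable _) (hk y), map_smul, smul_eq_mul]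
  intro t
  refine Prod.ext ?_ (Prod.ext ?_ ?_)
  · simp [kinv]
  · simp [kinv]
  · simp only [kinv, Prod.snd_add, Prod.smul_snd]
    module

theorem transport_comp_kinv {φ : Phase d → ℝ} (h : IsTest φ) {a b : ℝ} (ha : 0 < a)
    (hb : 0 < b) (z y : Phase d) :
    transport (fun y => φ (kinv a b z y)) y = a⁻¹ * transport φ (kinv a b z y) := by
  have hk := (contDiff_kinv a b z).differentiable (by simp)
  rw [transport_eq ((h.comp_kinv ha hb z).differentiable y), transport_eq (h.differentiable _),
    fderiv_comp_of_line (e' := a⁻¹ • (1, (kinv a b z y).2.2, 0)) (h.differentiable _) (hk y),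
    map_smul, smul_eq_mul]
  intro t
  refine Prod.ext ?_ (Prod.ext ?_ ?_)
  · simp [kinv]; ring
  · simp only [kinv, Prod.snd_add, Prod.smul_snd, Prod.fst_add, Prod.smul_fst, smul_eq_mul, mul_one,
      mul_inv]
    module
  · simp [kinv]

/-! ### Weak triples and their invariance under the kinetic scaling. -/

/-- `g = ∇_v f` and `(∂_t + v · ∇_x) f = ∇_v · F` in the sense of distributions. -/
structure IsWeakTriple (f : Phase d → ℝ) (g F : Phase d → Vec d) : Prop where
  locInt : LocallyIntegrable f
  locInt_grad : LocallyIntegrable g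
  locInt_flux : LocallyIntegrable F
  grad_eq : ∀ φ : Phase d → ℝ, IsTest φ → ∀ i : Fin d,
    ∫ z, f z * velGrad φ z i = - ∫ z, g z i * φ z
  flux_eq : ∀ φ : Phase d → ℝ, IsTest φ →
    ∫ z, f z * transport φ z = ∫ z, inner ℝ (F z) (velGrad φ z)

theorem locallyIntegrable_comp_kmap {E : Type*} [NormedAddCommGroup E] {u : Phase d → E}
    (hu : LocallyIntegrable u) {a b : ℝ} (ha : 0 < a) (hb : 0 < b) (z : Phase d) :
    LocallyIntegrable fun w => u (kmap a b z w) := by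
  have h := (locallyIntegrable_map_homeomorph (kmapHomeo ha hb z) (f := u) (μ := volume)).1
  refine h ?_
  change LocallyIntegrable u (Measure.map (kmap a b z) volume)
  rw [map_kmap ha hb]
  intro x
  obtain ⟨U, hU, h⟩ := hu x
  refine ⟨U, hU, ?_⟩
  rw [IntegrableOn, Measure.restrict_smul]
  exact h.smul_measure ENNReal.ofReal_ne_top

namespace IsWeakTriple

variable {f : Phase d → ℝ} {g F : Phase d → Vec d}

/-- Under the change of variables ∂_v picks up b and T picks up a; since the flux stands under one
∂_v, its factor is a / b. Test functions are transported by the inverse map, and the common Jacobian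
cancels. -/
theorem comp_kmap (h : IsWeakTriple f g F) {a b : ℝ} (ha : 0 < a) (hb : 0 < b) (z : Phase d) :
    IsWeakTriple (fun w => f (kmap a b z w)) (fun w => b • g (kmap a b z w))
      (fun w => (a / b) • F (kmap a b z w)) where
  locInt := locallyIntegrable_comp_kmap h.locInt ha hb z
  locInt_grad := (locallyIntegrable_comp_kmap h.locInt_grad ha hb z).smul b
  locInt_flux := (locallyIntegrable_comp_kmap h.locInt_flux ha hb z).smul (a / b)
  grad_eq φ hφ i := by
    have e1 := integral_kmap ha hb z fun y => f y * velGrad φ (kinv a b z y) i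
    have e2 := integral_kmap ha hb z fun y => (b • g y) i * φ (kinv a b z y)
    simp only [kinv_kmap ha hb] at e1 e2
    have e3 := h.grad_eq _ (hφ.comp_kinv ha hb z) i
    have e4 : ∀ y, velGrad φ (kinv a b z y) i = b * velGrad (fun y => φ (kinv a b z y)) y i := by
      intro y
      have := inner_velGrad_comp_kinv hφ ha hb z y (EuclideanSpace.single i 1)
      simp only [EuclideanSpace.inner_single_left, map_one, one_mul] at this
      rw [this, mul_inv_cancel_left₀ hb.ne']
    rw [e1, e2, ← smul_neg]
    congr 1
    simp only [e4, PiLp.smul_apply, smul_eq_mul, mul_assoc, mul_left_comm (f _) b]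
    rw [integral_const_mul, integral_const_mul, e3, mul_neg]
  flux_eq φ hφ := by
    have e1 := integral_kmap ha hb z fun y => f y * transport φ (kinv a b z y)
    have e2 := integral_kmap ha hb z fun y => inner ℝ ((a / b) • F y) (velGrad φ (kinv a b z y))
    simp only [kinv_kmap ha hb] at e1 e2
    have e3 := h.flux_eq _ (hφ.comp_kinv ha hb z)
    have e4 : ∀ y, transport φ (kinv a b z y) = a * transport (fun y => φ (kinv a b z y)) y := by
      intro y
      rw [transport_comp_kinv hφ ha hb, mul_inv_cancel_left₀ ha.ne']
    have e5 : ∀ y, inner ℝ ((a / b) • F y) (velGrad φ (kinv a b z y))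
        = a * inner ℝ (F y) (velGrad (fun y => φ (kinv a b z y)) y) := by
      intro y
      rw [inner_velGrad_comp_kinv hφ ha hb, real_inner_smul_left]
      field_simp
    rw [e1, e2]
    congr 1
    simp only [e4, e5, mul_left_comm (f _) a]
    rw [integral_const_mul, integral_const_mul, e3]

end IsWeakTriple

/-! ### The dilation generator in kinetic divergence form. -/

/-- The infinitesimal generator of the dilations `(e^{α u} t, e^{(α + β) u} x, e^{β u} v)` of unit
homogeneous dimension, acting on densities. -/
noncomputable def dilGen (α β : ℝ) (ρ : Phase d → ℝ) (w : Phase d) : ℝ :=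
  ρ w + fderiv ℝ ρ w (α * w.1, (α + β) • w.2.1, β • w.2.2)

theorem IsTest.dilGen {ρ : Phase d → ℝ} (h : IsTest ρ) (α β : ℝ) : IsTest (dilGen α β ρ) :=
  h.add (h.fderiv_apply (by fun_prop))

/-- The function `h_i` with which `∂_{x_i} h_i` is rewritten through the commutator of `∂_{v_i}`
and the transport operator. -/
noncomputable def shearDensity (α β : ℝ) (ρ : Phase d → ℝ) (i : Fin d) (w : Phase d) : ℝ :=
  ((α + β) * w.2.1 i - α * w.1 * w.2.2 i) * ρ w

/-- Coefficient of the flux potential. -/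
noncomputable def fluxDensity (α β : ℝ) (ρ : Phase d → ℝ) (w : Phase d) : ℝ :=
  α * w.1 * ρ w - ∑ i, velGrad (shearDensity α β ρ i) w i

/-- Coefficient of the velocity gradient. -/
noncomputable def gradDensity (α β : ℝ) (ρ : Phase d → ℝ) (i : Fin d) (w : Phase d) : ℝ :=
  β * w.2.2 i * ρ w + transport (shearDensity α β ρ i) w

theorem IsTest.shearDensity {ρ : Phase d → ℝ} (h : IsTest ρ) (α β : ℝ) (i : Fin d) :
    IsTest (shearDensity α β ρ i) :=
  h.contDiff_mul (by fun_prop)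

theorem IsTest.fluxDensity {ρ : Phase d → ℝ} (h : IsTest ρ) (α β : ℝ) :
    IsTest (fluxDensity α β ρ) :=
  (h.contDiff_mul (by fun_prop)).sub
    (IsTest.sum _ fun i _ => IsTest.velGrad (h.shearDensity α β i) i)

theorem IsTest.gradDensity {ρ : Phase d → ℝ} (h : IsTest ρ) (α β : ℝ) (i : Fin d) :
    IsTest (gradDensity α β ρ i) :=
  (h.contDiff_mul (by fun_prop)).add (h.shearDensity α β i).transport

/-- The commutator identity `[∂_{v_i}, ∂_t + v · ∇_x] = ∂_{x_i}`. -/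
theorem velGrad_transport_sub {φ : Phase d → ℝ} (h : IsTest φ) (i : Fin d) (z : Phase d) :
    velGrad (transport φ) z i - transport (fun w => velGrad φ w i) z
      = fderiv ℝ φ z (0, EuclideanSpace.single i 1, 0) := by
  have hd : DifferentiableAt ℝ (fderiv ℝ φ) z :=
    ((h.1.fderiv_right (m := ∞) (by simp)).differentiable (by simp)) z
  rw [velGrad_apply (h.transport.differentiable z), transport_eq ((h.velGrad i).differentiable z),
    h.transport_eq_fun, h.velGrad_apply_eq]
  have hL : HasFDerivAt (fun w : Phase d => ((1, w.2.2, 0) : Phase d))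
      ((0 : Phase d →L[ℝ] ℝ).prod (((ContinuousLinearMap.snd ℝ (Vec d) (Vec d)).comp
        (ContinuousLinearMap.snd ℝ ℝ (Vec d × Vec d))).prod 0)) z :=
    (hasFDerivAt_const _ _).prodMk ((((ContinuousLinearMap.snd ℝ (Vec d) (Vec d)).comp
        (ContinuousLinearMap.snd ℝ ℝ (Vec d × Vec d))).hasFDerivAt).prodMk (hasFDerivAt_const _ _))
  rw [(hd.hasFDerivAt.clm_apply hL).fderiv,
    (hd.hasFDerivAt.clm_apply (hasFDerivAt_const (0, 0, EuclideanSpace.single i 1) z)).fderiv]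
  -- The second-order terms cancel by symmetry; what survives comes from differentiating the
  -- coefficient v of T.
  have hsymm : IsSymmSndFDerivAt ℝ φ z := h.1.contDiffAt.isSymmSndFDerivAt (by
    rw [minSmoothness_of_isRCLikeNormedField]; exact WithTop.coe_le_coe.2 (le_top : (2 : ℕ∞) ≤ ⊤))
  have := hsymm.eq (0, 0, EuclideanSpace.single i 1) (1, z.2.2, 0)
  simp [this]

theorem fderiv_mul_apply {u ρ : Phase d → ℝ} {z : Phase d} (hu : DifferentiableAt ℝ u z)
    (hρ : DifferentiableAt ℝ ρ z) (e : Phase d) :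
    fderiv ℝ (fun w => u w * ρ w) z e = u z * fderiv ℝ ρ z e + ρ z * fderiv ℝ u z e := by
  rw [fderiv_fun_mul hu hρ]; simp

theorem clm_apply_eq_sum (L : Vec d →L[ℝ] ℝ) (e : Vec d) :
    L e = ∑ i, e i * L (EuclideanSpace.single i 1) := by
  have h := (EuclideanSpace.basisFun (Fin d) ℝ).sum_repr e
  nth_rw 1 [← h]
  simp [map_sum]

/-- Since the dilation field has divergence 1, the generator is the divergence of (αt, (α+β)x, βv)ρ.
Replacing ∂_t by T - v·∇_x leaves T(αtρ) + Σ ∂_{x_i} h_i + ∇_v·(βvρ), with h_i = `shearDensity`.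
Then ∂_{x_i} h_i = ∂_{v_i} T h_i - T ∂_{v_i} h_i distributes the x-derivatives between `fluxDensity`
and `gradDensity`. -/
theorem dilGen_eq {ρ : Phase d → ℝ} (h : IsTest ρ) {α β : ℝ}
    (hαβ : α + d * (α + β) + d * β = 1) (w : Phase d) :
    dilGen α β ρ w = transport (fluxDensity α β ρ) w + ∑ i, velGrad (gradDensity α β ρ i) w i := by
  have hρ := h.differentiable w
  have line : ∀ (u : Phase d → ℝ) (e : Phase d) (c : ℝ), DifferentiableAt ℝ u w →
      HasDerivAt (fun t : ℝ => u (w + t • e)) c 0 → fderiv ℝ u w e = c := by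
    intro u e c hu hc
    rw [← hu.lineDeriv_eq_fderiv, lineDeriv, hc.deriv]
  have t1 : transport (fluxDensity α β ρ) w = α * w.1 * fderiv ℝ ρ w (1, w.2.2, 0) + ρ w * α
      - ∑ i, transport (fun w => velGrad (shearDensity α β ρ i) w i) w := by
    have hs : ∀ i ∈ Finset.univ, DifferentiableAt ℝ
        (fun w => velGrad (shearDensity α β ρ i) w i) w :=
      fun i _ => ((h.shearDensity α β i).velGrad i).differentiable w
    have hu : DifferentiableAt ℝ (fun w : Phase d => α * w.1) w := by fun_prop
    rw [transport_eq ((h.fluxDensity α β).differentiable w)]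
    unfold fluxDensity
    rw [fderiv_fun_sub (hu.fun_mul hρ) (DifferentiableAt.fun_sum hs), fderiv_fun_sum hs,
      sub_apply, fderiv_mul_apply hu hρ, sum_apply,
      line _ (1, w.2.2, 0) α hu]
    · congr 1
      exact Finset.sum_congr rfl fun i hi => (transport_eq (hs i hi)).symm
    · simpa using ((hasDerivAt_id (0 : ℝ)).const_add w.1).const_mul α
  have t2 : ∀ i, velGrad (gradDensity α β ρ i) w i
      = β * w.2.2 i * fderiv ℝ ρ w (0, 0, EuclideanSpace.single i 1) + ρ w * β
        + velGrad (transport (shearDensity α β ρ i)) w i := by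
    intro i
    have hu : DifferentiableAt ℝ (fun w : Phase d => β * w.2.2 i) w := by fun_prop
    have hs := (h.shearDensity α β i).transport.differentiable w
    rw [velGrad_apply ((h.gradDensity α β i).differentiable w)]
    unfold gradDensity
    rw [fderiv_fun_add (hu.fun_mul hρ) hs, add_apply, fderiv_mul_apply hu hρ,
      line _ (0, 0, EuclideanSpace.single i 1) β hu, velGrad_apply hs]
    simpa using ((hasDerivAt_id (0 : ℝ)).const_add (w.2.2 i)).const_mul β
  have t3 : ∀ i, fderiv ℝ (shearDensity α β ρ i) w (0, EuclideanSpace.single i 1, 0)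
      = ((α + β) * w.2.1 i - α * w.1 * w.2.2 i) * fderiv ℝ ρ w (0, EuclideanSpace.single i 1, 0)
        + ρ w * (α + β) := by
    intro i
    have hu : DifferentiableAt ℝ
        (fun w : Phase d => (α + β) * w.2.1 i - α * w.1 * w.2.2 i) w := by fun_prop
    unfold shearDensity
    rw [fderiv_mul_apply hu hρ, line _ (0, EuclideanSpace.single i 1, 0) (α + β) hu]
    simpa using (((hasDerivAt_id (0 : ℝ)).const_add (w.2.1 i)).const_mul (α + β)).sub_const
      (α * w.1 * w.2.2 i)
  have hx : ∀ e : Vec d, fderiv ℝ ρ w (0, e, 0)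
      = ∑ i, e i * fderiv ℝ ρ w (0, EuclideanSpace.single i 1, 0) := by
    intro e
    exact clm_apply_eq_sum ((fderiv ℝ ρ w).comp ((ContinuousLinearMap.inr ℝ ℝ (Vec d × Vec d)).comp
      (ContinuousLinearMap.inl ℝ (Vec d) (Vec d)))) e
  have hv : ∀ e : Vec d, fderiv ℝ ρ w (0, 0, e)
      = ∑ i, e i * fderiv ℝ ρ w (0, 0, EuclideanSpace.single i 1) := by
    intro e
    exact clm_apply_eq_sum ((fderiv ℝ ρ w).comp ((ContinuousLinearMap.inr ℝ ℝ (Vec d × Vec d)).comp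
      (ContinuousLinearMap.inr ℝ (Vec d) (Vec d)))) e
  have comm : ∑ i, velGrad (transport (shearDensity α β ρ i)) w i
      = ∑ i, transport (fun w => velGrad (shearDensity α β ρ i) w i) w
        + ∑ i, fderiv ℝ (shearDensity α β ρ i) w (0, EuclideanSpace.single i 1, 0) := by
    rw [← Finset.sum_add_distrib]
    refine Finset.sum_congr rfl fun i _ => ?_
    rw [← velGrad_transport_sub (h.shearDensity α β i) i w]
    ring
  have split : fderiv ℝ ρ w (α * w.1, (α + β) • w.2.1, β • w.2.2)
      = α * w.1 * fderiv ℝ ρ w (1, 0, 0) + (α + β) * fderiv ℝ ρ w (0, w.2.1, 0)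
        + β * fderiv ℝ ρ w (0, 0, w.2.2) := by
    have : ((α * w.1, (α + β) • w.2.1, β • w.2.2) : Phase d)
      = (α * w.1) • (1, 0, 0) + (α + β) • (0, w.2.1, 0) + β • (0, 0, w.2.2) := by simp
    rw [this]
    simp only [map_add, map_smul, smul_eq_mul]
  have split' : fderiv ℝ ρ w (1, w.2.2, 0)
      = fderiv ℝ ρ w (1, 0, 0) + fderiv ℝ ρ w (0, w.2.2, 0) := by
    rw [← map_add]; simp
  simp only [t2, Finset.sum_add_distrib, comm]
  rw [t1, dilGen, split, split', hx w.2.1, hx w.2.2, hv w.2.2]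
  simp only [t3, Finset.sum_add_distrib, sub_mul, Finset.sum_sub_distrib, Finset.mul_sum,
    Finset.sum_const, Finset.card_univ, Fintype.card_fin, nsmul_eq_mul, mul_assoc, mul_add]
  linear_combination (-ρ w) * hαβ

theorem IsTest.integrable_mul {u φ : Phase d → ℝ} (hu : LocallyIntegrable u) (h : IsTest φ) :
    Integrable fun z => u z * φ z :=
  hu.integrable_smul_right_of_hasCompactSupport h.1.continuous h.2

theorem locallyIntegrable_apply {g : Phase d → Vec d} (hg : LocallyIntegrable g) (i : Fin d) :
    LocallyIntegrable fun z => g z i := fun x => by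
  obtain ⟨U, hU, h⟩ := hg x
  exact ⟨U, hU, (EuclideanSpace.proj (𝕜 := ℝ) i).integrable_comp h⟩

namespace IsWeakTriple

variable {f : Phase d → ℝ} {g F : Phase d → Vec d}

theorem integral_dilGen (h : IsWeakTriple f g F) {ρ : Phase d → ℝ} (hρ : IsTest ρ) {α β : ℝ}
    (hαβ : α + d * (α + β) + d * β = 1) :
    ∫ w, f w * dilGen α β ρ w = (∫ w, inner ℝ (F w) (velGrad (fluxDensity α β ρ) w))
      - ∑ i, ∫ w, g w i * gradDensity α β ρ i w := by
  have hs : ∀ i ∈ Finset.univ, Integrable fun w => f w * velGrad (gradDensity α β ρ i) w i :=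
    fun i _ => ((hρ.gradDensity α β i).velGrad i).integrable_mul h.locInt
  simp only [dilGen_eq hρ hαβ, mul_add, Finset.mul_sum]
  rw [integral_add ((hρ.fluxDensity α β).transport.integrable_mul h.locInt)
    (integrable_finsetSum _ hs), integral_finsetSum _ hs, h.flux_eq _ (hρ.fluxDensity α β)]
  simp only [h.grad_eq _ (hρ.gradDensity α β _), Finset.sum_neg_distrib, sub_eq_add_neg]

end IsWeakTriple

theorem enorm_integral_le_of_bound {E : Type*} [NormedAddCommGroup E]
    {G : Phase d → E} {r φ : Phase d → ℝ} {K : Set (Phase d)} (hK : MeasurableSet K) {M : ℝ≥0}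
    (hφ : ∀ w, ‖φ w‖ ≤ M) (hφK : ∀ w ∉ K, φ w = 0) (hr : ∀ w, ‖r w‖ ≤ ‖G w‖ * ‖φ w‖) :
    ‖∫ w, r w‖ₑ ≤ M * ∫⁻ w in K, ‖G w‖ₑ := by
  refine (enorm_integral_le_lintegral_enorm _).trans ?_
  rw [← lintegral_const_mul' _ _ ENNReal.coe_ne_top, ← lintegral_indicator hK]
  refine lintegral_mono fun w => ?_
  have h1 : ‖r w‖ₑ ≤ ‖G w‖ₑ * ‖φ w‖ₑ := by
    have := hr w
    simp only [enorm_eq_nnnorm]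
    exact_mod_cast this
  by_cases hw : w ∈ K
  · rw [Set.indicator_of_mem hw, mul_comm]
    refine h1.trans ?_
    gcongr
    have := hφ w
    rw [enorm_eq_nnnorm]
    exact_mod_cast this
  · rw [Set.indicator_of_notMem hw]
    simpa [hφK w hw] using h1

theorem IsTest.exists_bound {φ : Phase d → ℝ} (h : IsTest φ) : ∃ M : ℝ≥0, ∀ w, ‖φ w‖ ≤ M := by
  obtain ⟨C, hC⟩ := h.2.exists_bound_of_continuous h.1.continuous
  exact ⟨C.toNNReal, fun w => (hC w).trans (Real.le_coe_toNNReal C)⟩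

/-- The unit scale estimate for the variation of the mollification along dilations. -/
theorem exists_enorm_integral_dilGen_le {ρ : Phase d → ℝ} (hρ : IsTest ρ) {α β : ℝ}
    (hαβ : α + d * (α + β) + d * β = 1) :
    ∃ (K : Set (Phase d)) (M : ℝ≥0), IsCompact K ∧ (∀ w ∉ K, ρ w = 0) ∧ (∀ w, ‖ρ w‖ ≤ M) ∧
      ∀ (f : Phase d → ℝ) (g F : Phase d → Vec d), IsWeakTriple f g F →
        ‖∫ w, f w * dilGen α β ρ w‖ₑ ≤ M * ((∫⁻ w in K, ‖F w‖ₑ) + ∫⁻ w in K, ‖g w‖ₑ) := by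
  classical
  have hA := fun i : Fin d => (hρ.fluxDensity α β).velGrad i
  have hB := fun i : Fin d => hρ.gradDensity α β i
  choose MA hMA using fun i => (hA i).exists_bound
  choose MB hMB using fun i => (hB i).exists_bound
  obtain ⟨Mρ, hMρ⟩ := hρ.exists_bound
  -- One compact set and one bound serve ρ and all coefficients, so that a single averaging family
  -- is enough later.
  set K : Set (Phase d) := tsupport ρ ∪ ((⋃ i, tsupport fun w => velGrad (fluxDensity α β ρ) w i) ∪
    ⋃ i, tsupport (gradDensity α β ρ i)) with hKdef
  have hK : IsCompact K := hρ.2.isCompact.union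
    ((isCompact_iUnion fun i => (hA i).2.isCompact).union
      (isCompact_iUnion fun i => (hB i).2.isCompact))
  set M : ℝ≥0 := Mρ + (∑ i, MA i + ∑ i, MB i)
  refine ⟨K, M, hK, fun w hw => ?_, fun w => ?_, fun f g F h => ?_⟩
  · exact image_eq_zero_of_notMem_tsupport fun hc => hw (Or.inl hc)
  · exact (hMρ w).trans (by exact_mod_cast le_self_add)
  have bA : ∀ i, ‖∫ w, F w i * velGrad (fluxDensity α β ρ) w i‖ₑ ≤ MA i * ∫⁻ w in K, ‖F w‖ₑ := by
    refine fun i => enorm_integral_le_of_bound hK.measurableSet (hMA i) (fun w hw => ?_)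
      fun w => ?_
    · exact image_eq_zero_of_notMem_tsupport (f := fun w => velGrad (fluxDensity α β ρ) w i)
        fun hc => hw (Or.inr (Or.inl (Set.mem_iUnion.2 ⟨i, hc⟩)))
    · rw [norm_mul]
      gcongr
      exact PiLp.norm_apply_le _ _
  have bB : ∀ i, ‖∫ w, g w i * gradDensity α β ρ i w‖ₑ ≤ MB i * ∫⁻ w in K, ‖g w‖ₑ := by
    refine fun i => enorm_integral_le_of_bound hK.measurableSet (hMB i) (fun w hw => ?_)
      fun w => ?_
    · exact image_eq_zero_of_notMem_tsupport
        fun hc => hw (Or.inr (Or.inr (Set.mem_iUnion.2 ⟨i, hc⟩)))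
    · rw [norm_mul]
      gcongr
      exact PiLp.norm_apply_le _ _
  have hinner : ∫ w, inner ℝ (F w) (velGrad (fluxDensity α β ρ) w)
      = ∑ i, ∫ w, F w i * velGrad (fluxDensity α β ρ) w i := by
    rw [← integral_finsetSum _ fun i _ =>
      (hA i).integrable_mul (locallyIntegrable_apply h.locInt_flux i)]
    refine integral_congr_ae (.of_forall fun w => ?_)
    simp [PiLp.inner_apply, mul_comm]
  rw [h.integral_dilGen hρ hαβ, hinner]
  calc _ ≤ ‖∑ i, ∫ w, F w i * velGrad (fluxDensity α β ρ) w i‖ₑ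
        + ‖∑ i, ∫ w, g w i * gradDensity α β ρ i w‖ₑ := enorm_sub_le
    _ ≤ (∑ i, MA i * ∫⁻ w in K, ‖F w‖ₑ) + ∑ i, MB i * ∫⁻ w in K, ‖g w‖ₑ :=
        add_le_add ((enorm_sum_le _ _).trans (Finset.sum_le_sum fun i _ => bA i))
          ((enorm_sum_le _ _).trans (Finset.sum_le_sum fun i _ => bB i))
    _ ≤ M * (∫⁻ w in K, ‖F w‖ₑ) + M * ∫⁻ w in K, ‖g w‖ₑ := by
        rw [← Finset.sum_mul, ← Finset.sum_mul]
        have h1 : ∑ i, (MA i : ℝ≥0∞) ≤ M := by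
          exact_mod_cast (le_self_add.trans le_add_self : ∑ i, MA i ≤ M)
        have h2 : ∑ i, (MB i : ℝ≥0∞) ≤ M := by
          exact_mod_cast (le_add_self.trans le_add_self : ∑ i, MB i ≤ M)
        gcongr
    _ = _ := (mul_add _ _ _).symm

/-! ### Averages of f at varying scale and their control by potentials. -/

/-- The family of anisotropic dilations, centred at `z`, with scale parameter `u`. -/
noncomputable def scaleMap (a₀ b₀ α β u : ℝ) (z w : Phase d) : Phase d :=
  kmap (a₀ * Real.exp (α * u)) (b₀ * Real.exp (β * u)) z w

/-- The inverse of `scaleMap`. -/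
noncomputable def scaleInv (a₀ b₀ α β u : ℝ) (z y : Phase d) : Phase d :=
  kinv (a₀ * Real.exp (α * u)) (b₀ * Real.exp (β * u)) z y

theorem scale_jacobian {a₀ b₀ α β : ℝ} (h0 : a₀ ^ (1 + d) * b₀ ^ (2 * d) = 1)
    (hαβ : α + d * (α + β) + d * β = 1) (u : ℝ) :
    (a₀ * Real.exp (α * u)) ^ (1 + d) * (b₀ * Real.exp (β * u)) ^ (2 * d) = Real.exp u := by
  have : Real.exp (α * u) ^ (1 + d) * Real.exp (β * u) ^ (2 * d) = Real.exp u := by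
    rw [← Real.exp_nat_mul, ← Real.exp_nat_mul, ← Real.exp_add]
    congr 1
    push_cast
    linear_combination u * hαβ
  rw [mul_pow, mul_pow, ← this]
  linear_combination (Real.exp (α * u) ^ (1 + d) * Real.exp (β * u) ^ (2 * d)) * h0

theorem continuous_scaleMap (a₀ b₀ α β : ℝ) :
    Continuous fun t : ℝ × Phase d × Phase d => scaleMap a₀ b₀ α β t.1 t.2.1 t.2.2 :=
  continuous_kmap (by fun_prop) (by fun_prop) (by fun_prop) (by fun_prop)

theorem continuous_scaleInv {a₀ b₀ : ℝ} (ha : 0 < a₀) (hb : 0 < b₀) (α β : ℝ) (z : Phase d) :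
    Continuous fun t : ℝ × Phase d => scaleInv a₀ b₀ α β t.1 z t.2 := by
  have h1 : ∀ u : ℝ, a₀ * Real.exp (α * u) ≠ 0 := fun u => by positivity
  have h2 : ∀ u : ℝ, b₀ * Real.exp (β * u) ≠ 0 := fun u => by positivity
  have h3 : ∀ u : ℝ, a₀ * Real.exp (α * u) * (b₀ * Real.exp (β * u)) ≠ 0 :=
    fun u => mul_ne_zero (h1 u) (h2 u)
  unfold scaleInv kinv
  refine Continuous.prodMk ?_ (Continuous.prodMk ?_ ?_)
  · exact (Continuous.inv₀ (by fun_prop) fun t : ℝ × Phase d => h1 t.1).mul (by fun_prop)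
  · exact (Continuous.inv₀ (by fun_prop) fun t : ℝ × Phase d => h3 t.1).smul (by fun_prop)
  · exact (Continuous.inv₀ (by fun_prop) fun t : ℝ × Phase d => h2 t.1).smul (by fun_prop)

/-- Over the whole space the Jacobian relation is an equality with factor e^{-u}; restricting w to K
only lowers the left side. -/
theorem isAveragingFamily_scaleMap {a₀ b₀ α β : ℝ} (ha : 0 < a₀) (hb : 0 < b₀)
    (h0 : a₀ ^ (1 + d) * b₀ ^ (2 * d) = 1) (hαβ : α + d * (α + β) + d * β = 1)
    (K : Set (Phase d)) :
    IsAveragingFamily volume (volume.restrict K) (scaleMap a₀ b₀ α β : ℝ → Phase d → Phase d → _) where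
  measurable := (continuous_scaleMap a₀ b₀ α β).measurable
  measurePreserving u w := measurePreserving_kmap_left _ _ w
  lintegral_le u z G hG := by
    refine (lintegral_mono' Measure.restrict_le_self le_rfl).trans (le_of_eq ?_)
    unfold scaleMap
    rw [lintegral_kmap (by positivity) (by positivity) z hG, scale_jacobian h0 hαβ, Real.exp_neg]

/-- As u grows, the inverse dilation of a fixed y moves against the dilation field, and e^{-u}
contributes the zeroth-order term of `dilGen`. -/
theorem hasDerivAt_scaled_density (a₀ b₀ α β : ℝ)
    {ρ : Phase d → ℝ} (hρ : IsTest ρ) (z y : Phase d) (u : ℝ) :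
    HasDerivAt (fun u => Real.exp (-u) * ρ (scaleInv a₀ b₀ α β u z y))
      (-(Real.exp (-u) * dilGen α β ρ (scaleInv a₀ b₀ α β u z y))) u := by
  have hinv : ∀ c r : ℝ, HasDerivAt (fun u => (c * Real.exp (r * u))⁻¹)
      (-r * (c * Real.exp (r * u))⁻¹) u := by
    intro c r
    have : (fun u => (c * Real.exp (r * u))⁻¹) = fun u => c⁻¹ * Real.exp (-r * u) := by
      funext u; rw [mul_inv, ← Real.exp_neg, neg_mul]
    rw [this, mul_inv, ← Real.exp_neg, ← neg_mul]
    have h1 : HasDerivAt (fun u : ℝ => -r * u) (-r) u := by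
      simpa using (hasDerivAt_id u).const_mul (-r)
    convert! h1.exp.const_mul c⁻¹ using 1
    ring
  have hS : HasDerivAt (fun u => scaleInv a₀ b₀ α β u z y)
      (-(α * (scaleInv a₀ b₀ α β u z y).1, (α + β) • (scaleInv a₀ b₀ α β u z y).2.1,
        β • (scaleInv a₀ b₀ α β u z y).2.2)) u := by
    have e1 := (hinv a₀ α).mul_const (y.1 - z.1)
    have e2 := (hinv (a₀ * b₀) (α + β)).smul_const (y.2.1 - z.2.1 - (y.1 - z.1) • z.2.2)
    have e3 := (hinv b₀ β).smul_const (y.2.2 - z.2.2)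
    have e4 : ∀ u, a₀ * Real.exp (α * u) * (b₀ * Real.exp (β * u))
        = a₀ * b₀ * Real.exp ((α + β) * u) := by
      intro u; rw [add_mul, Real.exp_add]; ring
    unfold scaleInv kinv
    simp only [e4]
    convert! e1.prodMk (e2.prodMk e3) using 1
    refine Prod.ext ?_ (Prod.ext ?_ ?_)
    · simp [mul_assoc]
    · simp only [Prod.fst_neg, Prod.snd_neg, smul_smul, ← neg_smul, neg_mul]
    · simp only [Prod.snd_neg, smul_smul, ← neg_smul, neg_mul]
  have h1 := (hρ.differentiable (scaleInv a₀ b₀ α β u z y)).hasFDerivAt.comp_hasDerivAt u hS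
  have h2 := ((hasDerivAt_neg' u).exp).mul h1
  convert! h2 using 1
  simp only [dilGen, map_neg, Function.comp_apply]
  ring

/-- The average of `f` at scale `u` around `z`, with density `ρ`. -/
noncomputable def mollify (a₀ b₀ α β : ℝ) (ρ f : Phase d → ℝ) (u : ℝ) (z : Phase d) : ℝ :=
  ∫ w, f (scaleMap a₀ b₀ α β u z w) * ρ w

theorem scaleInv_scaleMap {a₀ b₀ : ℝ} (ha : 0 < a₀) (hb : 0 < b₀) (α β u : ℝ) (z w : Phase d) :
    scaleInv a₀ b₀ α β u z (scaleMap a₀ b₀ α β u z w) = w :=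
  kinv_kmap (by positivity) (by positivity) z w

theorem scaleMap_scaleInv {a₀ b₀ : ℝ} (ha : 0 < a₀) (hb : 0 < b₀) (α β u : ℝ) (z w : Phase d) :
    scaleMap a₀ b₀ α β u z (scaleInv a₀ b₀ α β u z w) = w :=
  kmap_kinv (by positivity) (by positivity) z w

/-- This moves the scale from f, which is only locally integrable, to the smooth ρ, where it can be
differentiated. -/
theorem mollify_eq {a₀ b₀ α β : ℝ} (ha : 0 < a₀) (hb : 0 < b₀)
    (h0 : a₀ ^ (1 + d) * b₀ ^ (2 * d) = 1) (hαβ : α + d * (α + β) + d * β = 1)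
    (ρ f : Phase d → ℝ) (u : ℝ) (z : Phase d) :
    mollify a₀ b₀ α β ρ f u z
      = ∫ y, f y * (Real.exp (-u) * ρ (scaleInv a₀ b₀ α β u z y)) := by
  have h := integral_kmap (a := a₀ * Real.exp (α * u)) (b := b₀ * Real.exp (β * u))
    (by positivity) (by positivity) z fun y => f y * ρ (scaleInv a₀ b₀ α β u z y)
  rw [scale_jacobian h0 hαβ, ← Real.exp_neg, smul_eq_mul, ← integral_const_mul] at h
  simp only [mul_left_comm (f _)]
  rw [← h, mollify]
  refine integral_congr_ae (.of_forall fun w => ?_)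
  change _ = f (scaleMap a₀ b₀ α β u z w) * ρ (scaleInv a₀ b₀ α β u z (scaleMap a₀ b₀ α β u z w))
  rw [scaleInv_scaleMap ha hb]

/-- The fundamental theorem of calculus for the mollification in the scale parameter. -/
theorem mollify_sub_mollify {a₀ b₀ α β : ℝ} (ha : 0 < a₀) (hb : 0 < b₀)
    (h0 : a₀ ^ (1 + d) * b₀ ^ (2 * d) = 1) (hαβ : α + d * (α + β) + d * β = 1)
    {ρ : Phase d → ℝ} (hρ : IsTest ρ) {f : Phase d → ℝ} (hf : LocallyIntegrable f) (z : Phase d)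
    {u u' : ℝ} (huu : u ≤ u') :
    mollify a₀ b₀ α β ρ f u z - mollify a₀ b₀ α β ρ f u' z
      = ∫ t in Set.Ioc u u', mollify a₀ b₀ α β (dilGen α β ρ) f t z := by
  have hE := hρ.dilGen α β
  have hSc := continuous_scaleInv ha hb α β z
  have hcont : Continuous fun t : ℝ × Phase d =>
      Real.exp (-t.1) * dilGen α β ρ (scaleInv a₀ b₀ α β t.1 z t.2) :=
    Continuous.mul (by fun_prop) (hE.1.continuous.comp hSc)
  have hint : ∀ {φ : Phase d → ℝ}, IsTest φ → ∀ t,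
      Integrable fun y => f y * (Real.exp (-t) * φ (scaleInv a₀ b₀ α β t z y)) := fun hφ t =>
    IsTest.integrable_mul hf (IsTest.contDiff_mul contDiff_const
      (hφ.comp_kinv (by positivity : 0 < a₀ * Real.exp (α * t))
        (by positivity : 0 < b₀ * Real.exp (β * t)) z))
  have hprod : Integrable (fun t : ℝ × Phase d =>
      f t.2 * (Real.exp (-t.1) * dilGen α β ρ (scaleInv a₀ b₀ α β t.1 z t.2)))
      ((volume.restrict (Set.Ioc u u')).prod volume) := by
    -- K contains every y reached from the support at scales in [u, u'], so the indicator of K times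
    -- |f| dominates the integrand and Fubini applies.
    set K : Set (Phase d) := (fun t : ℝ × Phase d => scaleMap a₀ b₀ α β t.1 z t.2) ''
      (Set.Icc u u' ×ˢ tsupport (dilGen α β ρ)) with hKdef
    have hK : IsCompact K := (isCompact_Icc.prod hE.2.isCompact).image
      ((continuous_scaleMap a₀ b₀ α β).comp (by fun_prop :
        Continuous fun t : ℝ × Phase d => (t.1, z, t.2)))
    obtain ⟨M, hM⟩ := hE.exists_bound
    have h1 : Integrable (fun t : ℝ × Phase d => (Real.exp (-u) * M) * K.indicator f t.2)
        ((volume.restrict (Set.Ioc u u')).prod volume) :=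
      (Integrable.mul_prod (f := fun _ : ℝ => Real.exp (-u) * M) (integrable_const _)
        ((integrable_indicator_iff hK.measurableSet).2 (hf.integrableOn_isCompact hK)))
    refine h1.mono ?_ ?_
    · exact (hf.aestronglyMeasurable.comp_snd).mul hcont.aestronglyMeasurable
    · filter_upwards [Measure.quasiMeasurePreserving_fst.ae (ae_restrict_mem measurableSet_Ioc)]
        with t ht
      by_cases hy : scaleInv a₀ b₀ α β t.1 z t.2 ∈ tsupport (dilGen α β ρ)
      · have hyK : t.2 ∈ K :=
          ⟨(t.1, scaleInv a₀ b₀ α β t.1 z t.2), ⟨⟨ht.1.le, ht.2⟩, hy⟩,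
            scaleMap_scaleInv ha hb α β t.1 z t.2⟩
        have h2 : Real.exp (-t.1) * ‖dilGen α β ρ (scaleInv a₀ b₀ α β t.1 z t.2)‖
            ≤ Real.exp (-u) * M :=
          mul_le_mul (Real.exp_le_exp.2 (neg_le_neg ht.1.le)) (hM _) (norm_nonneg _)
            (Real.exp_pos _).le
        rw [Set.indicator_of_mem hyK, norm_mul, norm_mul, norm_mul, Real.norm_of_nonneg
          (Real.exp_pos _).le, Real.norm_of_nonneg (by positivity : 0 ≤ Real.exp (-u) * M),
          mul_comm ‖f t.2‖]
        gcongr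
      · rw [image_eq_zero_of_notMem_tsupport hy, mul_zero, mul_zero, norm_zero]
        exact norm_nonneg _
  have hFTC : ∀ y, ∫ t in Set.Ioc u u',
      f y * (Real.exp (-t) * dilGen α β ρ (scaleInv a₀ b₀ α β t z y))
      = f y * (Real.exp (-u) * ρ (scaleInv a₀ b₀ α β u z y))
        - f y * (Real.exp (-u') * ρ (scaleInv a₀ b₀ α β u' z y)) := by
    intro y
    have h1 := intervalIntegral.integral_eq_sub_of_hasDerivAt
      (fun t _ => hasDerivAt_scaled_density a₀ b₀ α β hρ z y t)
      ((hcont.comp (by fun_prop : Continuous fun t : ℝ => (t, y))).neg.intervalIntegrable u u')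
    rw [intervalIntegral.integral_of_le huu] at h1
    rw [integral_const_mul, ← mul_sub, ← neg_sub (_ * _) (_ * _), ← h1]
    simp only [integral_neg, neg_neg]
  simp only [mollify_eq ha hb h0 hαβ]
  rw [integral_integral_swap hprod, ← integral_sub (hint hρ u) (hint hρ u')]
  simp only [hFTC]

/-- The mollification is controlled by the potentials of the flux and of the velocity gradient. -/
theorem enorm_mollify_le {a₀ b₀ α β : ℝ} (ha : 0 < a₀) (hb : 0 < b₀)
    (h0 : a₀ ^ (1 + d) * b₀ ^ (2 * d) = 1) (hαβ : α + d * (α + β) + d * β = 1)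
    {ρ : Phase d → ℝ} (hρ : IsTest ρ) {K : Set (Phase d)} {M : ℝ≥0} (hK : IsCompact K)
    (hρK : ∀ w ∉ K, ρ w = 0) (hρM : ∀ w, ‖ρ w‖ ≤ M)
    (hM : ∀ (f : Phase d → ℝ) (g F : Phase d → Vec d), IsWeakTriple f g F →
        ‖∫ w, f w * dilGen α β ρ w‖ₑ ≤ M * ((∫⁻ w in K, ‖F w‖ₑ) + ∫⁻ w in K, ‖g w‖ₑ))
    {f : Phase d → ℝ} {g F : Phase d → Vec d} (h : IsWeakTriple f g F) (hfm : Measurable f)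
    (hFm : Measurable F) (hf : MemLp f 2) (u : ℝ) (z : Phase d) :
    ‖mollify a₀ b₀ α β ρ f u z‖ₑ ≤ M *
      (ENNReal.ofReal (a₀ / b₀) *
        potential (volume.restrict K) (scaleMap a₀ b₀ α β) (α - β) (fun y => ‖F y‖ₑ) z
      + ENNReal.ofReal b₀ *
        potential (volume.restrict K) (scaleMap a₀ b₀ α β) β (fun y => ‖g y‖ₑ) z) := by
  have hfam := isAveragingFamily_scaleMap ha hb h0 hαβ K
  have : IsFiniteMeasure (volume.restrict K) := ⟨by simpa using hK.measure_lt_top⟩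
  set R := M * (ENNReal.ofReal (a₀ / b₀) *
        potential (volume.restrict K) (scaleMap a₀ b₀ α β) (α - β) (fun y => ‖F y‖ₑ) z
      + ENNReal.ofReal b₀ *
        potential (volume.restrict K) (scaleMap a₀ b₀ α β) β (fun y => ‖g y‖ₑ) z) with hR
  have hstep : ∀ t, ‖mollify a₀ b₀ α β (dilGen α β ρ) f t z‖ₑ ≤ M *
      (ENNReal.ofReal (a₀ / b₀) * (ENNReal.ofReal (Real.exp ((α - β) * t)) *
        ∫⁻ w in K, ‖F (scaleMap a₀ b₀ α β t z w)‖ₑ) + ENNReal.ofReal b₀ *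
        (ENNReal.ofReal (Real.exp (β * t)) * ∫⁻ w in K, ‖g (scaleMap a₀ b₀ α β t z w)‖ₑ)) := by
    intro t
    have ha' : 0 < a₀ * Real.exp (α * t) := by positivity
    have hb' : 0 < b₀ * Real.exp (β * t) := by positivity
    refine (hM _ _ _ (h.comp_kmap ha' hb' z)).trans (le_of_eq ?_)
    simp only [enorm_smul]
    rw [lintegral_const_mul' _ _ enorm_ne_top, lintegral_const_mul' _ _ enorm_ne_top,
      Real.enorm_of_nonneg hb'.le, Real.enorm_of_nonneg (by positivity), ENNReal.ofReal_mul hb.le]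
    have : a₀ * Real.exp (α * t) / (b₀ * Real.exp (β * t))
        = a₀ / b₀ * Real.exp ((α - β) * t) := by
      rw [sub_mul, Real.exp_sub]; field_simp
    rw [this, ENNReal.ofReal_mul (by positivity), mul_assoc, mul_assoc]
    rfl
  -- The increment between two scales is at most the integral over all scales, which is R whatever
  -- u' is.
  have hdiff : ∀ u', u ≤ u' →
      ‖mollify a₀ b₀ α β ρ f u z‖ₑ ≤ R + ‖mollify a₀ b₀ α β ρ f u' z‖ₑ := by
    intro u' huu
    have h1 := mollify_sub_mollify ha hb h0 hαβ hρ h.locInt z huu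
    rw [sub_eq_iff_eq_add] at h1
    rw [h1]
    refine (enorm_add_le _ _).trans (add_le_add ?_ le_rfl)
    refine (enorm_integral_le_lintegral_enorm _).trans ?_
    refine (setLIntegral_le_lintegral _ _).trans ((lintegral_mono hstep).trans (le_of_eq ?_))
    have hm : ∀ {G : Phase d → ℝ≥0∞}, Measurable G → ∀ s : ℝ, Measurable fun t : ℝ =>
        ENNReal.ofReal (Real.exp (s * t)) * ∫⁻ w in K, G (scaleMap a₀ b₀ α β t z w) :=
      fun hG s => (hfam.measurable_integrand hG s).comp
        (by fun_prop : Measurable fun t : ℝ => (t, z))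
    rw [lintegral_const_mul' _ _ ENNReal.coe_ne_top,
      lintegral_add_left ((hm hFm.enorm _).const_mul _),
      lintegral_const_mul' _ _ ENNReal.ofReal_ne_top, lintegral_const_mul' _ _ ENNReal.ofReal_ne_top]
    rfl
  set N : ℝ≥0∞ := (∫⁻ x, ‖f x‖ₑ ^ (2 : ℝ)) ^ (2 : ℝ)⁻¹ * (volume.restrict K) Set.univ ^ (1 - (2 : ℝ)⁻¹)
    with hN
  have hNfin : N ≠ ⊤ := by
    have h2 : ∫⁻ x, ‖f x‖ₑ ^ (2 : ℝ) ≠ ⊤ := by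
      have := (lintegral_rpow_enorm_lt_top_of_eLpNorm_lt_top (p := 2) (by simp) (by simp) hf.2).ne
      simpa using this
    refine ENNReal.mul_ne_top (ENNReal.rpow_ne_top_of_nonneg (by norm_num) h2)
      (ENNReal.rpow_ne_top_of_nonneg (by norm_num) (measure_ne_top _ _))
  -- Hölder with exponent 2 gives decay e^{-u'/2}; this removes the boundary term at infinite scale.
  have hdecay : ∀ u', ‖mollify a₀ b₀ α β ρ f u' z‖ₑ ≤
      ENNReal.ofReal (Real.exp (-(2 : ℝ)⁻¹ * u')) * (M * N) := by
    intro u'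
    refine (enorm_integral_le_of_bound (G := fun w => f (scaleMap a₀ b₀ α β u' z w))
      hK.measurableSet hρM hρK fun w => (norm_mul _ _).le).trans ?_
    refine (mul_le_mul_right (hfam.average_le_rpow hfm.enorm (p := 2) (by norm_num) u' z) _).trans
      (le_of_eq ?_)
    rw [hN]; ring
  have hlim : Filter.Tendsto (fun u' : ℝ => R + ENNReal.ofReal (Real.exp (-(2 : ℝ)⁻¹ * u')) * (M * N))
      Filter.atTop (nhds (R + 0 * (M * N))) := by
    refine tendsto_const_nhds.add (ENNReal.Tendsto.mul_const ?_
      (Or.inr (ENNReal.mul_ne_top ENNReal.coe_ne_top hNfin)))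
    rw [← ENNReal.ofReal_zero]
    refine ENNReal.tendsto_ofReal (Real.tendsto_exp_atBot.comp ?_)
    exact Filter.tendsto_id.const_mul_atTop_of_neg (by norm_num)
  rw [zero_mul, add_zero] at hlim
  refine ge_of_tendsto hlim ?_
  filter_upwards [Filter.eventually_ge_atTop u] with u' hu'
  exact (hdiff u' hu').trans (add_le_add le_rfl (hdecay u'))

/-! ### Recovery of f from its averages at small scales. -/

theorem measurePreserving_scaleMap (a₀ b₀ α β u : ℝ) (w : Phase d) :
    MeasurePreserving fun z : Phase d => scaleMap a₀ b₀ α β u z w :=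
  measurePreserving_kmap_left _ _ w

/-- Continuity of Galilean translations in `L²`. -/
theorem tendsto_eLpNorm_comp_scaleMap_sub {α β : ℝ} (a₀ b₀ : ℝ) (hα : 0 < α) (hβ : 0 < β)
    {f : Phase d → ℝ} (hf : MemLp f 2) (w : Phase d) :
    Filter.Tendsto (fun u => eLpNorm (fun z => f (scaleMap a₀ b₀ α β u z w) - f z) 2)
      Filter.atBot (nhds 0) := by
  -- The map remains continuous and measure preserving at a = b = 0, where it is the identity in z.
  -- Composition with measure-preserving maps is continuous on L² in the compact-open topology.
  let T : C((ℝ × ℝ) × Phase d, Phase d) := ⟨fun t => kmap t.1.1 t.1.2 t.2 w,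
    continuous_kmap (by fun_prop) (by fun_prop) (by fun_prop) (by fun_prop)⟩
  have hexp : ∀ c r : ℝ, 0 < r →
      Filter.Tendsto (fun u => c * Real.exp (r * u)) Filter.atBot (nhds 0) := by
    intro c r hr
    have : Filter.Tendsto (fun u => Real.exp (r * u)) Filter.atBot (nhds 0) :=
      Real.tendsto_exp_atBot.comp (Filter.tendsto_id.const_mul_atBot hr)
    simpa using this.const_mul c
  have hT : Filter.Tendsto (fun u => T.curry (a₀ * Real.exp (α * u), b₀ * Real.exp (β * u)))
      Filter.atBot (nhds (T.curry (0, 0))) :=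
    (T.curry.continuous.tendsto (0, 0)).comp ((hexp a₀ α hα).prodMk_nhds (hexp b₀ β hβ))
  have hmp : ∀ a b : ℝ, MeasurePreserving (T.curry (a, b)) (volume : Measure (Phase d)) volume :=
    fun a b => measurePreserving_kmap_left a b w
  have : Fact ((1 : ℝ≥0∞) ≤ 2) := ⟨by norm_num⟩
  have key := Filter.Tendsto.compMeasurePreservingLp
    (tendsto_const_nhds (x := hf.toLp f) (f := Filter.atBot (α := ℝ))) hT (fun u => hmp _ _)
    (hmp 0 0) (by norm_num)
  simp only [Lp.toLp_compMeasurePreserving hf] at key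
  rw [Lp.tendsto_Lp_iff_tendsto_eLpNorm''] at key
  convert key using 2 with u
  congr 1
  funext z
  simp only [Pi.sub_apply, Function.comp_apply]
  congr 2
  change z = kmap 0 0 z w
  simp [kmap]

/-- If all mollifications of `f` are bounded by `H`, so is `f`. -/
theorem ae_enorm_le_of_mollify_le {a₀ b₀ α β : ℝ} (ha : 0 < a₀) (hb : 0 < b₀) (hα : 0 < α)
    (hβ : 0 < β) {ρ : Phase d → ℝ} (hρ : IsTest ρ) (hρ1 : ∫ w, ρ w = 1) {K : Set (Phase d)}
    {M : ℝ≥0} (hK : IsCompact K) (hρK : ∀ w ∉ K, ρ w = 0) (hρM : ∀ w, ‖ρ w‖ ≤ M)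
    {f : Phase d → ℝ} (hfm : Measurable f) (hfl : LocallyIntegrable f) (hf : MemLp f 2)
    {H : Phase d → ℝ≥0∞} (hH : ∀ u z, ‖mollify a₀ b₀ α β ρ f u z‖ₑ ≤ H z) :
    ∀ᵐ z, ‖f z‖ₑ ≤ H z := by
  have : IsFiniteMeasure (volume.restrict K) := ⟨by simpa using hK.measure_lt_top⟩
  have hS := (continuous_scaleMap (d := d) a₀ b₀ α β).measurable
  have hdiff : ∀ u z, ‖mollify a₀ b₀ α β ρ f u z - f z‖ₑ ≤
      M * ∫⁻ w in K, ‖f (scaleMap a₀ b₀ α β u z w) - f z‖ₑ := by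
    intro u z
    have h1 : mollify a₀ b₀ α β ρ f u z - f z
        = ∫ w, (f (scaleMap a₀ b₀ α β u z w) - f z) * ρ w := by
      have e1 : Integrable fun w => f (scaleMap a₀ b₀ α β u z w) * ρ w :=
        hρ.integrable_mul (locallyIntegrable_comp_kmap hfl (by positivity) (by positivity) z)
      have e2 : Integrable fun w => f z * ρ w :=
        (hρ.1.continuous.integrable_of_hasCompactSupport hρ.2).const_mul _
      simp only [sub_mul]
      rw [integral_sub e1 e2, integral_const_mul, hρ1, mul_one, mollify]
    rw [h1]
    exact enorm_integral_le_of_bound (G := fun w => f (scaleMap a₀ b₀ α β u z w) - f z)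
      hK.measurableSet hρM hρK fun w => (norm_mul _ _).le
  set D : ℕ → Phase d → Phase d → ℝ≥0∞ := fun n z w =>
    ‖f (scaleMap a₀ b₀ α β (-(n : ℝ)) z w) - f z‖ₑ with hD
  have hDm : ∀ n, Measurable fun t : Phase d × Phase d => D n t.1 t.2 := fun n =>
    ((hfm.comp (hS.comp (by fun_prop : Measurable fun t : Phase d × Phase d =>
      (-(n : ℝ), t.1, t.2)))).sub (hfm.comp measurable_fst)).enorm
  have hnorm : ∀ h : Phase d → ℝ, ∫⁻ z, ‖h z‖ₑ ^ (2 : ℝ) = eLpNorm h 2 ^ (2 : ℝ) := fun h => by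
    have := (eLpNorm_nnreal_pow_eq_lintegral (μ := (volume : Measure (Phase d))) (f := h) (p := 2)
      (by norm_num)).symm
    simpa using this
  -- Dominated convergence in w on K: each translation error tends to 0 and is at most (2‖f‖₂)², as
  -- translations preserve the norm.
  have hQ : Filter.Tendsto (fun n => ∫⁻ w in K, ∫⁻ z, D n z w ^ (2 : ℝ)) Filter.atTop (nhds 0) := by
    have h1 := tendsto_lintegral_of_dominated_convergence (μ := volume.restrict K)
      (F := fun n w => ∫⁻ z, D n z w ^ (2 : ℝ)) (f := fun _ => 0)
      (fun _ => (eLpNorm f 2 + eLpNorm f 2) ^ (2 : ℝ))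
      (fun n => Measurable.lintegral_prod_left' (f := fun t : Phase d × Phase d =>
        D n t.1 t.2 ^ (2 : ℝ)) ((hDm n).pow_const _)) (fun n => .of_forall fun w => ?_) ?_
      (.of_forall fun w => ?_)
    · simpa using h1
    · simp only [hD]
      rw [hnorm fun z => f (scaleMap a₀ b₀ α β (-(n : ℝ)) z w) - f z]
      gcongr
      have hmp := measurePreserving_scaleMap a₀ b₀ α β (-(n : ℝ)) w
      refine (eLpNorm_sub_le (hf.1.comp_measurePreserving hmp) hf.1 (by norm_num)).trans ?_
      rw [eLpNorm_comp_measurePreserving hf.1 hmp]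
    · rw [lintegral_const]
      exact ENNReal.mul_ne_top (ENNReal.rpow_ne_top_of_nonneg (by norm_num)
        (ENNReal.add_ne_top.2 ⟨hf.2.ne, hf.2.ne⟩)) (measure_ne_top _ _)
    · simp only [hD]
      have h2 := (tendsto_eLpNorm_comp_scaleMap_sub a₀ b₀ hα hβ hf w).comp
        (Filter.tendsto_neg_atTop_atBot.comp tendsto_natCast_atTop_atTop)
      have h3 := h2.ennrpow_const (2 : ℝ)
      rw [ENNReal.zero_rpow_of_pos (by norm_num)] at h3
      refine h3.congr fun n => ?_
      exact (hnorm fun z => f (scaleMap a₀ b₀ α β (-(n : ℝ)) z w) - f z).symm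
  have hmoll : ∀ u, StronglyMeasurable (mollify a₀ b₀ α β ρ f u) := fun u =>
    StronglyMeasurable.integral_prod_right' (f := fun t : Phase d × Phase d =>
      f (scaleMap a₀ b₀ α β u t.1 t.2) * ρ t.2)
      ((hfm.comp (hS.comp (by fun_prop : Measurable fun t : Phase d × Phase d =>
        (u, t.1, t.2)))).mul (hρ.1.continuous.measurable.comp measurable_snd)).stronglyMeasurable
  have hL2 : Filter.Tendsto (fun n : ℕ => eLpNorm (mollify a₀ b₀ α β ρ f (-(n : ℝ)) - f) 2)
      Filter.atTop (nhds 0) := by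
    -- Cauchy–Schwarz in w, then Tonelli to exchange z and w.
    have hbound : ∀ n : ℕ, eLpNorm (mollify a₀ b₀ α β ρ f (-(n : ℝ)) - f) 2 ≤
        ((M : ℝ≥0∞) ^ (2 : ℝ) * (volume.restrict K) Set.univ *
          ∫⁻ w in K, ∫⁻ z, D n z w ^ (2 : ℝ)) ^ (2 : ℝ)⁻¹ := by
      intro n
      rw [ENNReal.le_rpow_inv_iff (by norm_num), ← hnorm]
      calc _ ≤ ∫⁻ z, (M : ℝ≥0∞) ^ (2 : ℝ) * (volume.restrict K) Set.univ *
              ∫⁻ w in K, D n z w ^ (2 : ℝ) := by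
            refine lintegral_mono fun z => ?_
            refine (ENNReal.rpow_le_rpow (hdiff _ z) (by norm_num)).trans ?_
            rw [ENNReal.mul_rpow_of_nonneg _ _ (by norm_num), mul_assoc]
            gcongr
            have h4 := lintegral_le_lintegral_rpow_mul (volume.restrict K)
              ((hDm n).comp (measurable_const.prodMk measurable_id :
                Measurable fun w : Phase d => (z, w))).aemeasurable (p := 2) (by norm_num)
            refine (ENNReal.rpow_le_rpow h4 (by norm_num)).trans (le_of_eq ?_)
            rw [ENNReal.mul_rpow_of_nonneg _ _ (by norm_num), ← ENNReal.rpow_mul,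
              ← ENNReal.rpow_mul]
            norm_num
            exact mul_comm _ _
        _ = _ := by
            rw [lintegral_const_mul _ (Measurable.lintegral_prod_right' (f := fun t :
              Phase d × Phase d => D n t.1 t.2 ^ (2 : ℝ)) ((hDm n).pow_const _)),
              lintegral_lintegral_swap ((hDm n).pow_const _).aemeasurable]
    have hlim : Filter.Tendsto (fun n => ((M : ℝ≥0∞) ^ (2 : ℝ) * (volume.restrict K) Set.univ *
          ∫⁻ w in K, ∫⁻ z, D n z w ^ (2 : ℝ)) ^ (2 : ℝ)⁻¹) Filter.atTop (nhds 0) := by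
      have h5 := (ENNReal.Tendsto.const_mul (a := (M : ℝ≥0∞) ^ (2 : ℝ) *
        (volume.restrict K) Set.univ) hQ (Or.inr (ENNReal.mul_ne_top
          (ENNReal.rpow_ne_top_of_nonneg (by norm_num) ENNReal.coe_ne_top)
          (measure_ne_top _ _)))).ennrpow_const (2 : ℝ)⁻¹
      rwa [mul_zero, ENNReal.zero_rpow_of_pos (by norm_num)] at h5
    exact tendsto_of_tendsto_of_tendsto_of_le_of_le tendsto_const_nhds hlim (fun _ => zero_le)
      hbound
  -- L² convergence gives almost everywhere convergence along a subsequence, and the bound by H is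
  -- uniform in the scale.
  obtain ⟨ns, -, hns⟩ := (tendstoInMeasure_of_tendsto_eLpNorm (by norm_num)
    (fun n : ℕ => (hmoll (-(n : ℝ))).aestronglyMeasurable) hf.1 hL2).exists_seq_tendsto_ae
  filter_upwards [hns] with z hz
  exact le_of_tendsto' ((continuous_enorm.tendsto (f z)).comp hz) fun n => hH _ z

/-! ### From weak solutions to weak triples with measurable representatives. -/

theorem IsWeakTriple.congr {f f' : Phase d → ℝ} {g g' F F' : Phase d → Vec d}
    (h : IsWeakTriple f g F) (hf : f =ᵐ[volume] f') (hg : g =ᵐ[volume] g')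
    (hF : F =ᵐ[volume] F') : IsWeakTriple f' g' F' where
  locInt := h.locInt.congr hf
  locInt_grad := h.locInt_grad.congr hg
  locInt_flux := h.locInt_flux.congr hF
  grad_eq φ hφ i := by
    rw [← integral_congr_ae (hf.mono fun z hz => by simp only [hz] :
        (fun z => f z * velGrad φ z i) =ᵐ[volume] fun z => f' z * velGrad φ z i),
      ← integral_congr_ae (hg.mono fun z hz => by simp only [hz] :
        (fun z => g z i * φ z) =ᵐ[volume] fun z => g' z i * φ z), h.grad_eq φ hφ i]
  flux_eq φ hφ := by
    rw [← integral_congr_ae (hf.mono fun z hz => by simp only [hz] :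
        (fun z => f z * transport φ z) =ᵐ[volume] fun z => f' z * transport φ z),
      ← integral_congr_ae (hF.mono fun z hz => by simp only [hz] :
        (fun z => inner ℝ (F z) (velGrad φ z)) =ᵐ[volume] fun z => inner ℝ (F' z) (velGrad φ z)),
      h.flux_eq φ hφ]

/-- The superposition of a Carathéodory field with measurable functions is measurable. -/
theorem IsCaratheodory.aestronglyMeasurable_comp {A : Phase d → ℝ → Vec d → Vec d}
    (hA : IsCaratheodory A) {f : Phase d → ℝ} {g : Phase d → Vec d}
    (hf : AEStronglyMeasurable f) (hg : AEStronglyMeasurable g) :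
    AEStronglyMeasurable fun z => A z (f z) (g z) := by
  have hy : AEStronglyMeasurable fun z => (f z, g z) := hf.prodMk hg
  -- For simple arguments the superposition is a finite sum of the sections A(·, η, ξ) cut off to
  -- level sets; continuity in (η, ξ) then passes to the limit.
  have hs : ∀ s : SimpleFunc (Phase d) (ℝ × Vec d),
      AEStronglyMeasurable fun z => A z (s z).1 (s z).2 := by
    intro s
    have : (fun z => A z (s z).1 (s z).2)
        = fun z => ∑ c ∈ s.range, (s ⁻¹' {c}).indicator (fun z => A z c.1 c.2) z := by
      funext z
      rw [Finset.sum_eq_single_of_mem (s z) (s.mem_range_self z)]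
      · simp
      · intro c _ hc
        exact Set.indicator_of_notMem (fun h => hc h.symm) _
    rw [this]
    exact Finset.aestronglyMeasurable_fun_sum _ fun c _ =>
      (hA.measurable c.1 c.2).indicator (s.measurableSet_fiber c)
  refine aestronglyMeasurable_of_tendsto_ae Filter.atTop
    (fun n => hs (hy.stronglyMeasurable_mk.approx n)) ?_
  filter_upwards [hA.continuous, hy.ae_eq_mk] with z hz hyz
  have h1 := hy.stronglyMeasurable_mk.tendsto_approx z
  rw [← hyz] at h1
  exact (hz.tendsto (f z, g z)).comp h1

/-- A weak solution, together with its gradient and flux, is a weak triple. -/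
theorem IsWeakSolution.isWeakTriple {A : Phase d → ℝ → Vec d → Vec d} {f : Phase d → ℝ}
    {g : Phase d → Vec d} (h : IsWeakSolution A f g)
    (hF : LocallyIntegrable fun z => A z (f z) (g z)) :
    IsWeakTriple f g fun z => A z (f z) (g z) where
  locInt := h.isWeakVelGrad.locallyIntegrable
  locInt_grad := h.isWeakVelGrad.locallyIntegrable_grad
  locInt_flux := hF
  grad_eq := h.isWeakVelGrad.integral_eq
  flux_eq φ hφ := by
    have e1 : Integrable fun z => f z * transport φ z :=
      hφ.transport.integrable_mul h.isWeakVelGrad.locallyIntegrable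
    have e2 : Integrable fun z => inner ℝ (A z (f z) (g z)) (velGrad φ z) := by
      simp only [PiLp.inner_apply]
      refine integrable_finsetSum _ fun i _ => ?_
      simpa [mul_comm] using (hφ.velGrad i).integrable_mul (locallyIntegrable_apply hF i)
    have h1 := h.integral_eq φ hφ
    rw [integral_add (f := fun z => -(f z * transport φ z)) e1.neg e2, integral_neg] at h1
    linarith

/-! ### The linear estimate with one free scaling parameter. -/

/-- The linear kinetic Sobolev inequality with a free scaling parameter `μ`. -/
theorem exists_norm_le_of_isWeakTriple (d : ℕ) {p q s s' : ℝ} (hp : 1 < p) (hs : 0 < s)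
    (hs' : 0 < s') (hq : 1 ≤ q) (hqs : q⁻¹ = p⁻¹ - s) (hqs' : q⁻¹ = (1 - p⁻¹) - s')
    (hss : (3 * d + 1) * s + (d + 1) * s' = 1) :
    ∃ C : ℝ≥0∞, C ≠ ⊤ ∧ ∀ μ : ℝ, 0 < μ → ∀ (f : Phase d → ℝ) (g F : Phase d → Vec d),
      IsWeakTriple f g F → Measurable f → Measurable g → Measurable F → MemLp f 2 →
      ∫⁻ z, ‖g z‖ₑ ^ p ≠ ⊤ → ∫⁻ z, ‖F z‖ₑ ^ (p / (p - 1)) ≠ ⊤ →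
      (∫⁻ z, ‖f z‖ₑ ^ q) ^ q⁻¹ ≤ C *
        (ENNReal.ofReal (μ ^ (-((3 * (d : ℝ) + 1) / (d + 1)))) *
            (∫⁻ z, ‖F z‖ₑ ^ (p / (p - 1))) ^ (1 - p⁻¹)
          + ENNReal.ofReal μ * (∫⁻ z, ‖g z‖ₑ ^ p) ^ p⁻¹) := by
  have hp1 : 0 < p - 1 := by linarith
  have hq0 : 0 < q := by linarith
  have hp'inv : (p / (p - 1))⁻¹ = 1 - p⁻¹ := by field_simp
  have hp' : 1 < p / (p - 1) := by rw [one_lt_div hp1]; linarith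
  have hvv : (volume : Measure (Vec d × Vec d)).IsOpenPosMeasure := inferInstance
  have : (volume : Measure (Phase d)).IsOpenPosMeasure :=
    Measure.prod.instIsOpenPosMeasure (μ := (volume : Measure ℝ))
  let bump : ContDiffBump (0 : Phase d) := ⟨1, 2, one_pos, one_lt_two⟩
  set ρ : Phase d → ℝ := bump.normed volume with hρdef
  have hρ : IsTest ρ := ⟨bump.contDiff_normed, bump.hasCompactSupport_normed⟩
  have hρ1 : ∫ w, ρ w = 1 := bump.integral_normed
  -- The choice β = s and α = s + s' makes the potential of g have order s and that of F order α - β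
  -- = s'.
  have hαβ : (s + s') + d * ((s + s') + s) + d * s = 1 := by linear_combination hss
  obtain ⟨K, M, hK, hρK, hρM, hM⟩ := exists_enorm_integral_dilGen_le hρ hαβ
  have : IsFiniteMeasure (volume.restrict K) := ⟨by simpa using hK.measure_lt_top⟩
  obtain ⟨C₁, hC₁, H₁⟩ := IsAveragingFamily.potential_norm_le (μ := (volume : Measure (Phase d)))
    (ν := volume.restrict K) hs' hp' hq0 (by rw [hp'inv]; exact hqs')
  obtain ⟨C₂, hC₂, H₂⟩ := IsAveragingFamily.potential_norm_le (μ := (volume : Measure (Phase d)))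
    (ν := volume.restrict K) hs hp hq0 hqs
  refine ⟨M * (C₁ + C₂), ENNReal.mul_ne_top ENNReal.coe_ne_top (ENNReal.add_ne_top.2 ⟨hC₁, hC₂⟩),
    fun μ hμ f g F h hfm hgm hFm hf hg hF => ?_⟩
  set κ : ℝ := (3 * (d : ℝ) + 1) / (d + 1) with hκ
  -- Here b₀ = μ, and a₀ = μ^{1-κ} is forced by a₀^{1+d} b₀^{2d} = 1; the flux then carries the
  -- factor a₀ / b₀ = μ^{-κ}.
  have ha : 0 < μ ^ (1 - κ) := by positivity
  have h0 : (μ ^ (1 - κ)) ^ (1 + d) * μ ^ (2 * d) = 1 := by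
    rw [← Real.rpow_natCast, ← Real.rpow_natCast, ← Real.rpow_mul hμ.le, ← Real.rpow_add hμ]
    have : (1 - κ) * ((1 + d : ℕ) : ℝ) + ((2 * d : ℕ) : ℝ) = 0 := by
      rw [hκ]; push_cast; field_simp; ring
    rw [this, Real.rpow_zero]
  have hab : μ ^ (1 - κ) / μ = μ ^ (-κ) := by
    rw [← Real.rpow_sub_one hμ.ne']; congr 1; ring
  have hfam := isAveragingFamily_scaleMap ha hμ h0 hαβ K
  set P₁ := potential (volume.restrict K) (scaleMap (μ ^ (1 - κ)) μ (s + s') s) s'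
    (fun y => ‖F y‖ₑ) with hP₁
  set P₂ := potential (volume.restrict K) (scaleMap (μ ^ (1 - κ)) μ (s + s') s) s
    (fun y => ‖g y‖ₑ) with hP₂
  have hP₁m : Measurable P₁ := hfam.measurable_potential hFm.enorm s'
  have hP₂m : Measurable P₂ := hfam.measurable_potential hgm.enorm s
  have hmoll : ∀ u z, ‖mollify (μ ^ (1 - κ)) μ (s + s') s ρ f u z‖ₑ ≤
      M * (ENNReal.ofReal (μ ^ (-κ)) * P₁ z + ENNReal.ofReal μ * P₂ z) := by
    intro u z
    have := enorm_mollify_le ha hμ h0 hαβ hρ hK hρK hρM hM h hfm hFm hf u z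
    rwa [add_sub_cancel_left, hab] at this
  have hae := ae_enorm_le_of_mollify_le ha hμ (by positivity) hs hρ hρ1 hK hρK hρM hfm h.locInt hf
    hmoll
  have norm_const : ∀ (c : ℝ≥0∞), c ≠ ⊤ → ∀ P : Phase d → ℝ≥0∞,
      (∫⁻ z, (c * P z) ^ q) ^ q⁻¹ = c * (∫⁻ z, P z ^ q) ^ q⁻¹ := by
    intro c hc P
    simp only [ENNReal.mul_rpow_of_nonneg _ _ hq0.le]
    rw [lintegral_const_mul' _ _ (ENNReal.rpow_ne_top_of_nonneg hq0.le hc),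
      ENNReal.mul_rpow_of_nonneg _ _ (inv_nonneg.2 hq0.le), ← ENNReal.rpow_mul,
      mul_inv_cancel₀ hq0.ne', ENNReal.rpow_one]
  have b₁ := H₁ _ hfam (fun y => ‖F y‖ₑ) hFm.enorm hF
  have b₂ := H₂ _ hfam (fun y => ‖g y‖ₑ) hgm.enorm hg
  rw [hp'inv] at b₁
  calc (∫⁻ z, ‖f z‖ₑ ^ q) ^ q⁻¹
      ≤ (∫⁻ z, (M * (ENNReal.ofReal (μ ^ (-κ)) * P₁ z + ENNReal.ofReal μ * P₂ z)) ^ q) ^ q⁻¹ := by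
        refine ENNReal.rpow_le_rpow (lintegral_mono_ae ?_) (inv_nonneg.2 hq0.le)
        exact hae.mono fun z hz => ENNReal.rpow_le_rpow hz hq0.le
    _ = M * (∫⁻ z, (ENNReal.ofReal (μ ^ (-κ)) * P₁ z + ENNReal.ofReal μ * P₂ z) ^ q) ^ q⁻¹ :=
        norm_const M ENNReal.coe_ne_top _
    _ ≤ M * ((∫⁻ z, (ENNReal.ofReal (μ ^ (-κ)) * P₁ z) ^ q) ^ q⁻¹
          + (∫⁻ z, (ENNReal.ofReal μ * P₂ z) ^ q) ^ q⁻¹) := by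
        gcongr
        have := ENNReal.lintegral_Lp_add_le (μ := (volume : Measure (Phase d)))
          (hP₁m.const_mul (ENNReal.ofReal (μ ^ (-κ)))).aemeasurable
          (hP₂m.const_mul (ENNReal.ofReal μ)).aemeasurable hq
        simpa only [Pi.add_apply, one_div] using this
    _ = M * (ENNReal.ofReal (μ ^ (-κ)) * (∫⁻ z, P₁ z ^ q) ^ q⁻¹
          + ENNReal.ofReal μ * (∫⁻ z, P₂ z ^ q) ^ q⁻¹) := by
        rw [norm_const _ ENNReal.ofReal_ne_top, norm_const _ ENNReal.ofReal_ne_top]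
    _ ≤ M * (ENNReal.ofReal (μ ^ (-κ)) * ((C₁ + C₂) * (∫⁻ z, ‖F z‖ₑ ^ (p / (p - 1))) ^ (1 - p⁻¹))
          + ENNReal.ofReal μ * ((C₁ + C₂) * (∫⁻ z, ‖g z‖ₑ ^ p) ^ p⁻¹)) := by
        gcongr
        · exact b₁.trans (by gcongr; exact le_self_add)
        · exact b₂.trans (by gcongr; exact le_add_self)
    _ = _ := by ring

/-- The growth condition bounds the flux by a power of the velocity gradient. -/
theorem HasGrowth.lintegral_flux_le {p Λ : ℝ} (hp : 1 < p) (hΛ : 0 ≤ Λ)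
    {A : Phase d → ℝ → Vec d → Vec d} (hA : HasGrowth p Λ A) (f : Phase d → ℝ)
    (g : Phase d → Vec d) :
    ∫⁻ z, ‖A z (f z) (g z)‖ₑ ^ (p / (p - 1))
      ≤ ENNReal.ofReal Λ ^ (p / (p - 1)) * ∫⁻ z, ‖g z‖ₑ ^ p := by
  have hp1 : 0 < p - 1 := by linarith
  have hp' : 0 ≤ p / (p - 1) := by positivity
  rw [← lintegral_const_mul' _ _ (ENNReal.rpow_ne_top_of_nonneg hp' ENNReal.ofReal_ne_top)]
  refine lintegral_mono_ae (hA.mono fun z hz => ?_)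
  have h1 : ‖A z (f z) (g z)‖ₑ ≤ ENNReal.ofReal Λ * ‖g z‖ₑ ^ (p - 1) := by
    rw [← ofReal_norm, ← ofReal_norm,
      ENNReal.ofReal_rpow_of_nonneg (norm_nonneg _) hp1.le, ← ENNReal.ofReal_mul hΛ]
    exact ENNReal.ofReal_le_ofReal (hz _ _)
  refine (ENNReal.rpow_le_rpow h1 hp').trans (le_of_eq ?_)
  rw [ENNReal.mul_rpow_of_nonneg _ _ hp', ← ENNReal.rpow_mul, mul_div_cancel₀ _ hp1.ne']

theorem eLpNorm_ofReal_eq {E : Type*} [NormedAddCommGroup E] {r : ℝ} (hr : 0 < r)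
    (h : Phase d → E) :
    eLpNorm h (ENNReal.ofReal r) volume = (∫⁻ z, ‖h z‖ₑ ^ r) ^ r⁻¹ := by
  rw [eLpNorm_eq_lintegral_rpow_enorm_toReal (by simpa using hr) ENNReal.ofReal_ne_top,
    ENNReal.toReal_ofReal hr.le, one_div]

end KineticPGrowth

/-! ### The nonlinear estimate: choice of orders and optimisation of the scaling. -/

open KineticPGrowth in
theorem corollary3p1 (d : ℕ) (hd : 1 ≤ d) (p : ℝ)
    (hp₁ : 2 - 2 / (3 * (d : ℝ) + 2) < p) (hp₂ : p < 2 + 2 / (d : ℝ))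
    (Λ : ℝ) (hΛ : 0 < Λ) :
    ∃ C : ℝ, 0 < C ∧
      ∀ A : KineticPGrowth.Phase d → ℝ → KineticPGrowth.Vec d → KineticPGrowth.Vec d,
        KineticPGrowth.IsCaratheodory A → KineticPGrowth.HasGrowth p Λ A →
      ∀ (f : KineticPGrowth.Phase d → ℝ) (g : KineticPGrowth.Phase d → KineticPGrowth.Vec d),
        MemLp f 2 volume → MemLp g (ENNReal.ofReal p) volume →
        KineticPGrowth.IsWeakSolution A f g →
        MemLp f (ENNReal.ofReal (p * ((4 * (d : ℝ) + 2) / ((d : ℝ) * (p + 2))))) volume ∧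
        eLpNorm f (ENNReal.ofReal (p * ((4 * (d : ℝ) + 2) / ((d : ℝ) * (p + 2))))) volume
          ≤ ENNReal.ofReal C *
            eLpNorm g (ENNReal.ofReal p) volume
              ^ (((p + 2) * (d : ℝ) + p) / (4 * (d : ℝ) + 2)) := by
  have hd1 : (1 : ℝ) ≤ d := by exact_mod_cast hd
  have hd0 : (0 : ℝ) < d := by linarith
  have hlow : 6 * (d : ℝ) + 2 < p * (3 * d + 2) := by
    have h1 := mul_lt_mul_of_pos_right hp₁ (by positivity : 0 < 3 * (d : ℝ) + 2)
    rw [sub_mul, div_mul_cancel₀ _ (by positivity)] at h1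
    linarith
  have hhigh : p * d < 2 * d + 2 := by
    have h1 := mul_lt_mul_of_pos_right hp₂ hd0
    rwa [add_mul, div_mul_cancel₀ _ hd0.ne'] at h1
  have hp : 1 < p := by nlinarith
  have hp0 : 0 < p := by linarith
  have hp1 : 0 < p - 1 := by linarith
  set q : ℝ := p * ((4 * (d : ℝ) + 2) / ((d : ℝ) * (p + 2))) with hqdef
  set e : ℝ := ((p + 2) * (d : ℝ) + p) / (4 * (d : ℝ) + 2) with hedef
  -- These solve 1/q = 1/p - s = 1 - 1/p - s' together with (3d+1)s + (d+1)s' = 1. The upper bound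
  -- on p is s > 0, the lower one s' > 0.
  set s : ℝ := (2 * (d + 1) - d * p) / (p * (4 * d + 2)) with hsdef
  set s' : ℝ := (p * (3 * d + 2) - (6 * d + 2)) / (p * (4 * d + 2)) with hs'def
  have hs : 0 < s := div_pos (by linarith) (by positivity)
  have hs' : 0 < s' := div_pos (by linarith) (by positivity)
  have hq1 : 1 ≤ q := by
    rw [hqdef, ← mul_div_assoc, one_le_div (by positivity)]
    nlinarith
  have hq0 : 0 < q := by linarith
  have hqs : q⁻¹ = p⁻¹ - s := by
    rw [hqdef, hsdef]; field_simp; ring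
  have hqs' : q⁻¹ = (1 - p⁻¹) - s' := by
    rw [hqdef, hs'def]; field_simp; ring
  have hss : (3 * (d : ℝ) + 1) * s + (d + 1) * s' = 1 := by
    rw [hsdef, hs'def]; field_simp; ring
  obtain ⟨C, hC, H⟩ := exists_norm_le_of_isWeakTriple d hp hs hs' hq1 hqs hqs' hss
  set κ : ℝ := (3 * (d : ℝ) + 1) / (d + 1) with hκ
  set B : ℝ≥0∞ := C * (ENNReal.ofReal Λ + 1) with hB
  have hBfin : B ≠ ⊤ := ENNReal.mul_ne_top hC (by simp)
  refine ⟨B.toReal + 1, by positivity, fun A hA hgrowth f g hf hg hsol => ?_⟩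
  have hgN := eLpNorm_ofReal_eq hp0 g
  set N := eLpNorm g (ENNReal.ofReal p) volume with hN
  have hNfin : N ≠ ⊤ := hg.2.ne
  have hNp : ∫⁻ z, ‖g z‖ₑ ^ p = N ^ p := by
    rw [hgN, ← ENNReal.rpow_mul, inv_mul_cancel₀ hp0.ne', ENNReal.rpow_one]
  have hp'0 : 0 < p / (p - 1) := by positivity
  set F : Phase d → Vec d := fun z => A z (f z) (g z) with hFdef
  have hFm : AEStronglyMeasurable F := hA.aestronglyMeasurable_comp hf.1 hg.1
  have hFle := hgrowth.lintegral_flux_le hp hΛ.le f g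
  rw [hNp] at hFle
  have hFfin : ∫⁻ z, ‖F z‖ₑ ^ (p / (p - 1)) ≠ ⊤ :=
    ne_top_of_le_ne_top (ENNReal.mul_ne_top
      (ENNReal.rpow_ne_top_of_nonneg hp'0.le ENNReal.ofReal_ne_top)
      (ENNReal.rpow_ne_top_of_nonneg hp0.le hNfin)) hFle
  have hFnorm : (∫⁻ z, ‖F z‖ₑ ^ (p / (p - 1))) ^ (1 - p⁻¹) ≤ ENNReal.ofReal Λ * N ^ (p - 1) := by
    have hx : 0 ≤ 1 - p⁻¹ := by rw [sub_nonneg]; exact inv_le_one_of_one_le₀ hp.le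
    refine (ENNReal.rpow_le_rpow hFle hx).trans (le_of_eq ?_)
    rw [ENNReal.mul_rpow_of_nonneg _ _ hx, ← ENNReal.rpow_mul, ← ENNReal.rpow_mul]
    have e1 : p / (p - 1) * (1 - p⁻¹) = 1 := by field_simp
    have e2 : p * (1 - p⁻¹) = p - 1 := by field_simp
    rw [e1, e2, ENNReal.rpow_one]
  have hFLp : MemLp F (ENNReal.ofReal (p / (p - 1))) := by
    refine ⟨hFm, ?_⟩
    rw [eLpNorm_ofReal_eq hp'0]
    exact ENNReal.rpow_lt_top_of_nonneg (by positivity) hFfin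
  have hFloc : LocallyIntegrable F := hFLp.locallyIntegrable (by
    rw [ENNReal.one_le_ofReal, one_le_div hp1]; linarith)
  have htri := (hsol.isWeakTriple hFloc).congr hf.1.ae_eq_mk hg.1.ae_eq_mk hFm.ae_eq_mk
  have lint_congr : ∀ {E : Type} [NormedAddCommGroup E] {h h' : Phase d → E} (r : ℝ),
      h =ᵐ[volume] h' → ∫⁻ z, ‖h' z‖ₑ ^ r = ∫⁻ z, ‖h z‖ₑ ^ r := fun r hh =>
    lintegral_congr_ae (hh.mono fun z hz => by simp only [hz])
  have key : ∀ μ : ℝ, 0 < μ → eLpNorm f (ENNReal.ofReal q) volume ≤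
      C * (ENNReal.ofReal (μ ^ (-κ)) * (ENNReal.ofReal Λ * N ^ (p - 1)) + ENNReal.ofReal μ * N) := by
    intro μ hμ
    have h1 := H μ hμ _ _ _ htri hf.1.stronglyMeasurable_mk.measurable
      hg.1.stronglyMeasurable_mk.measurable hFm.stronglyMeasurable_mk.measurable
      ((memLp_congr_ae hf.1.ae_eq_mk).1 hf)
      (by rw [lint_congr p hg.1.ae_eq_mk, hNp]; exact ENNReal.rpow_ne_top_of_nonneg hp0.le hNfin)
      (by rw [lint_congr _ hFm.ae_eq_mk]; exact hFfin)
    rw [lint_congr p hg.1.ae_eq_mk, lint_congr _ hFm.ae_eq_mk, lint_congr q hf.1.ae_eq_mk, ← hgN,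
      ← eLpNorm_ofReal_eq hq0] at h1
    exact h1.trans (by gcongr)
  have hBle : B ≤ ENNReal.ofReal (B.toReal + 1) := by
    rw [← ENNReal.ofReal_toReal hBfin]
    exact ENNReal.ofReal_le_ofReal (by rw [ENNReal.toReal_ofReal ENNReal.toReal_nonneg]; linarith)
  have he0 : 0 < e := by positivity
  have main : eLpNorm f (ENNReal.ofReal q) volume ≤ ENNReal.ofReal (B.toReal + 1) * N ^ e := by
    by_cases hN0 : N = 0
    -- If N = 0 there is nothing to balance: both terms vanish for any μ, because p > 1.
    · refine (key 1 one_pos).trans ?_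
      rw [hN0, ENNReal.zero_rpow_of_pos hp1]
      simp
    · set n : ℝ := N.toReal with hn
      have hn0 : 0 < n := ENNReal.toReal_pos hN0 hNfin
      have hNn : N = ENNReal.ofReal n := (ENNReal.ofReal_toReal hNfin).symm
      -- Balancing μ^{-κ} N^{p-1} with μN gives μ^{1+κ} = N^{p-2}, where 1 + κ = (4d+2)/(d+1); hence
      -- μ = N^θ, and both terms are N^{1+θ} = N^e up to the factor Λ.
      set θ : ℝ := (p - 2) * (d + 1) / (4 * d + 2) with hθ
      have t1 : ENNReal.ofReal (n ^ θ) * N = N ^ e := by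
        rw [hNn, ENNReal.ofReal_rpow_of_pos hn0, ← ENNReal.ofReal_mul (by positivity),
          ← Real.rpow_add_one hn0.ne']
        congr 2
        rw [hθ, hedef]; field_simp; ring
      have t2 : ENNReal.ofReal ((n ^ θ) ^ (-κ)) * N ^ (p - 1) = N ^ e := by
        rw [hNn, ENNReal.ofReal_rpow_of_pos hn0, ENNReal.ofReal_rpow_of_pos hn0,
          ← ENNReal.ofReal_mul (by positivity), ← Real.rpow_mul hn0.le, ← Real.rpow_add hn0]
        congr 2
        rw [hθ, hedef, hκ]; field_simp; ring
      refine (key (n ^ θ) (by positivity)).trans ?_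
      rw [mul_left_comm, t1, t2]
      calc C * (ENNReal.ofReal Λ * N ^ e + N ^ e) = B * N ^ e := by rw [hB]; ring
        _ ≤ _ := by gcongr
  refine ⟨⟨hf.1, main.trans_lt ?_⟩, main⟩
  exact ENNReal.mul_lt_top ENNReal.ofReal_lt_top (ENNReal.rpow_lt_top_of_nonneg he0.le hNfin)
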